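/- Let $(M,g)$ be a Riemannian manifold with Levi-Civita connection $\nabla$ and let $\varphi:L\to M$ be an isometric immersion of codimension $q$, with $n=\dim L$; $TL$ is regarded as a subbundle of $TM|L=\varphi^{-1}TM$, with orthogonal complement $T^\perp L$, and $\nabla^\top$, $\nabla^\perp$ denote the connections in $TL$ and $T^\perp L$ obtained from $\nabla$ by orthogonal projection. Let $P=O(T^\perp L)$ be the bundle of orthonormal frames $(p,e)=(p,e_1,\dots,e_q)$ of $T^\perp L$ (or, if $L$ is transversally oriented, $P=SO(T^\perp L)$, the bundle of oriented ones), with projection $\pi_P:P\to L$. For $X\in T_pL$ let $X^h\in T_{(p,e)}P$ be its horizontal lift with respect to $\nabla^\perp$. Let $E=\pi_P^{-1}TL$, so that $E_{(p,e)}=T_pL$, with the pull-back connection $\nabla^E$ of $\nabla^\top$, and with the induced connection in $\mathrm{End}(E)$, $(\nabla^E_\xi T)Y=\nabla^E_\xi(TY)-T(\nabla^E_\xi Y)$. For endomorphisms $\mathbf A=(A_1,\dots,A_q)$ of a finite-dimensional vector space let $\sigma_u$, $u\in\mathbb N^q$, be the coefficient of $t^u=t_1^{u_1}\cdots t_q^{u_q}$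 in $\det(I+t_1A_1+\dots+t_qA_q)$, and define the generalized Newton transformation by $T_0=I$ and, for $u\neq0$, $$T_u=\sigma_u I-\sum_{\alpha:\,u_\alpha\ge1}A_\alpha T_{\alpha_\flat(u)},$$ where $\alpha_\flat(u)$ is obtained from $u$ by subtracting $1$ from the $\alpha$-th entry. At $(p,e)\in P$ apply this to the shape operators $A_\alpha=A^{e_\alpha}$, $A^{N}X=-(\nabla_XN)^\top$; thus $T_u$ becomes a section of $\mathrm{End}(E)$. For $W\in\Gamma(E)$ and $T\in\Gamma(\mathrm{End}(E))$ put, with $(e_i)$ any orthonormal basis of $T_pL$, $$\mathrm{div}_E W=\sum_i g(\nabla^E_{e_i^h}W,e_i),\qquad \mathrm{div}_E T=\sum_i(\nabla^E_{e_i^h}T)e_i .$$ Then for every $u\in\mathbb N^q$ and every smooth section $Y\in\Gamma(E)$, at every point of $P$, $$\mathrm{div}_E(T_uY)=\sum_i g\big(\nabla^E_{(T_ue_i)^h}Y,e_i\big)+g(\mathrm{div}_E T_u,Y).$$ -/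

import Mathlib

open Bundle Filter Topology Manifold
open scoped ContDiff RealInnerProductSpace

noncomputable section

/-! ### Symmetric functions and the generalized Newton transformation -/

section Newton

variable {V : Type*} [AddCommGroup V] [Module ℝ V] [FiniteDimensional ℝ V] {q : ℕ}

/-- The characteristic polynomial `det (I + t₁ A₁ + ⋯ + t_q A_q)` of a system of endomorphisms,
as a polynomial in the indeterminates `t₁, …, t_q` (computed in some basis of `V`). -/
def systemCharpoly (A : Fin q → Module.End ℝ V) : MvPolynomial (Fin q) ℝ :=
  Matrix.det (1 + ∑ α, (MvPolynomial.X α : MvPolynomial (Fin q) ℝ) •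
    (LinearMap.toMatrix (Module.finBasis ℝ V) (Module.finBasis ℝ V) (A α)).map
      (MvPolynomial.C : ℝ →+* MvPolynomial (Fin q) ℝ))

/-- The symmetric function `σ_u`: the coefficient of `t^u` in the characteristic polynomial. -/
def symmFun (A : Fin q → Module.End ℝ V) (u : Fin q →₀ ℕ) : ℝ :=
  MvPolynomial.coeff u (systemCharpoly A)

/-- The multi-index `α_♭(u)`: subtract one in the coordinate `α` (used only if `u α ≠ 0`). -/
def flat (α : Fin q) (u : Fin q →₀ ℕ) : Fin q →₀ ℕ := u - Finsupp.single α 1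

theorem degree_flat_lt {α : Fin q} {u : Fin q →₀ ℕ} (h : u α ≠ 0) :
    (flat α u).degree < u.degree := by
  have h1 : Finsupp.single α 1 ≤ u := by
    rw [Finsupp.single_le_iff]; omega
  have h2 : flat α u + Finsupp.single α 1 = u := tsub_add_cancel_of_le h1
  have h3 : (flat α u).degree + 1 = u.degree := by
    conv_rhs => rw [← h2]
    rw [map_add, Finsupp.degree_single]
  omega

/-- The generalized Newton transformation: `T_0 = I` and
`T_u = σ_u I - ∑_α A_α T_{α_♭(u)}`, where the terms whose multi-index `α_♭(u)` would have a
negative entry are zero. -/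
def newton (A : Fin q → Module.End ℝ V) (u : Fin q →₀ ℕ) : Module.End ℝ V :=
  if u = 0 then 1
  else symmFun A u • (1 : Module.End ℝ V) -
    ∑ α, if h : u α ≠ 0 then A α * newton A (flat α u) else 0
termination_by u.degree
decreasing_by exact degree_flat_lt h

end Newton

/-! ### Connections on tangent bundles and their pull-backs -/

section Connections

variable {EM : Type*} [NormedAddCommGroup EM] [NormedSpace ℝ EM]
  {HM : Type*} [TopologicalSpace HM] (IM : ModelWithCorners ℝ EM HM)
  {M : Type*} [TopologicalSpace M] [ChartedSpace HM M] [IsManifold IM ∞ M]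

instance finiteDimensional_tangentSpace [FiniteDimensional ℝ EM] (x : M) :
    FiniteDimensional ℝ (TangentSpace IM x) :=
  inferInstanceAs (FiniteDimensional ℝ EM)

/-- The identification of `T_x M` with the model space through the preferred chart at `c`
(an isomorphism if `x` is in the source of that chart). -/
def toCoord (c x : M) : TangentSpace IM x →L[ℝ] EM :=
  (trivializationAt EM (TangentSpace IM : M → Type _) c).continuousLinearMapAt ℝ x

/-- The inverse of `toCoord`. -/
def ofCoord (c x : M) : EM →L[ℝ] TangentSpace IM x :=
  (trivializationAt EM (TangentSpace IM : M → Type _) c).symmL ℝ x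

/-- The vector field with value `v` at `c` and with constant components
in the preferred chart at `c`. -/
def coordField (c : M) (v : TangentSpace IM c) (x : M) : TangentSpace IM x :=
  ofCoord IM c x (toCoord IM c c v)

/-- A (not yet specified) connection: `D Y x v` stands for `(∇_v Y)(x)`. -/
abbrev ConnectionOn (M : Type*) [TopologicalSpace M] [ChartedSpace HM M] :=
  (∀ x : M, TangentSpace IM x) → ∀ x : M, TangentSpace IM x →ₗ[ℝ] TangentSpace IM x

variable {IM} {EN : Type*} [NormedAddCommGroup EN] [NormedSpace ℝ EN]
  {HN : Type*} [TopologicalSpace HN] (IN : ModelWithCorners ℝ EN HN)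
  {N : Type*} [TopologicalSpace N] [ChartedSpace HN N]

/-- The pull-back along `f : N → M` of a connection `D` on `TM`, applied to a section `Y` of the
pull-back bundle `f⁻¹ TM` over a submanifold `S` of `N`. If `Y = ∑ Yᵏ (∂ₖ ∘ f)` in the preferred
chart at `f x`, then `∇_ξ Y = ∑ (ξ Yᵏ) ∂ₖ + ∑ Yᵏ D_{f_* ξ} ∂ₖ`. It is meaningful for `ξ` tangent
to `S`, where it does not depend on the extension of `Y` from `S` to `N`. -/
def pullbackConnection (D : ConnectionOn IM M) (f : N → M) (S : Set N)
    (Y : ∀ y : N, TangentSpace IM (f y)) (x : N) :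
    TangentSpace IN x →ₗ[ℝ] TangentSpace IM (f x) :=
  (ofCoord IM (f x) (f x)).toLinearMap ∘ₗ
      (mvfderivWithin IN (fun y => toCoord IM (f x) (f y) (Y y)) S x).toLinearMap +
    (D (coordField IM (f x) (Y x)) (f x)) ∘ₗ (mfderiv IN IM f x).toLinearMap

variable (IM)

theorem trilinear_add {A : Type*} [TopologicalSpace A] [AddCommGroup A] [Module ℝ A]
    (D : A →L[ℝ] EM →L[ℝ] EM →L[ℝ] ℝ) (u u' : A) (v w : EM) :
    D (u + u') v w = D u v w + D u' v w :=
  congrArg (fun B : EM →L[ℝ] EM →L[ℝ] ℝ => B v w) (D.map_add u u')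

theorem trilinear_smul {A : Type*} [TopologicalSpace A] [AddCommGroup A] [Module ℝ A]
    (D : A →L[ℝ] EM →L[ℝ] EM →L[ℝ] ℝ) (r : ℝ) (u : A) (v w : EM) :
    D (r • u) v w = r * D u v w :=
  congrArg (fun B : EM →L[ℝ] EM →L[ℝ] ℝ => B v w) (D.map_smul r u)

variable [FiniteDimensional ℝ EM] [RiemannianBundle (fun x : M => TangentSpace IM x)]

/-- The components of the metric in the preferred chart at `c`. -/
def metricCoord (c x : M) : EM →L[ℝ] EM →L[ℝ] ℝ :=
  (innerSL ℝ (E := TangentSpace IM x)).bilinearComp (ofCoord IM c x) (ofCoord IM c x)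

/-- The derivative at `c` of the components of the metric in the preferred chart at `c`:
`metricDeriv c u v w = u ⟨V, W⟩`, with `V`, `W` the coordinate fields extending `v`, `w`. -/
def metricDeriv (c : M) (u v w : TangentSpace IM c) : ℝ :=
  mvfderiv IM (metricCoord IM c) c u (toCoord IM c c v) (toCoord IM c c w)

theorem metricDeriv_add₁ (c : M) (u u' v w : TangentSpace IM c) :
    metricDeriv IM c (u + u') v w = metricDeriv IM c u v w + metricDeriv IM c u' v w :=
  trilinear_add (mvfderiv IM (metricCoord IM c) c) u u' _ _

theorem metricDeriv_smul₁ (c : M) (r : ℝ) (u v w : TangentSpace IM c) :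
    metricDeriv IM c (r • u) v w = r * metricDeriv IM c u v w :=
  trilinear_smul (mvfderiv IM (metricCoord IM c) c) r u _ _

theorem metricDeriv_add₂ (c : M) (u v v' w : TangentSpace IM c) :
    metricDeriv IM c u (v + v') w = metricDeriv IM c u v w + metricDeriv IM c u v' w :=
  ((mvfderiv IM (metricCoord IM c) c u).flip (toCoord IM c c w) ∘L toCoord IM c c).map_add v v'

theorem metricDeriv_smul₂ (c : M) (r : ℝ) (u v w : TangentSpace IM c) :
    metricDeriv IM c u (r • v) w = r * metricDeriv IM c u v w :=
  ((mvfderiv IM (metricCoord IM c) c u).flip (toCoord IM c c w) ∘L toCoord IM c c).map_smul r v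

/-- The Christoffel symbols `Γ(u, v)` at `c` in the preferred chart at `c`, given by
`2 ⟨Γ(u, v), w⟩ = u ⟨V, W⟩ + v ⟨U, W⟩ - w ⟨U, V⟩` for coordinate fields `U`, `V`, `W`;
here as a linear map of `u`. -/
def christoffel (c : M) (v : TangentSpace IM c) : TangentSpace IM c →ₗ[ℝ] TangentSpace IM c where
  toFun u := ∑ j, ((1 / 2 : ℝ) *
      (metricDeriv IM c u v (stdOrthonormalBasis ℝ (TangentSpace IM c) j) +
        metricDeriv IM c v u (stdOrthonormalBasis ℝ (TangentSpace IM c) j) -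
        metricDeriv IM c (stdOrthonormalBasis ℝ (TangentSpace IM c) j) u v)) •
    stdOrthonormalBasis ℝ (TangentSpace IM c) j
  map_add' u u' := by
    rw [← Finset.sum_add_distrib]
    refine Finset.sum_congr rfl fun j _ => ?_
    rw [← add_smul, metricDeriv_add₁, metricDeriv_add₂, metricDeriv_add₂]
    congr 1
    ring
  map_smul' r u := by
    rw [Finset.smul_sum]
    refine Finset.sum_congr rfl fun j _ => ?_
    rw [smul_smul, metricDeriv_smul₁, metricDeriv_smul₂, metricDeriv_smul₂, RingHom.id_apply]
    congr 1
    ring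

/-- The Levi-Civita connection of the Riemannian metric of `M`. -/
def leviCivita : ConnectionOn IM M := fun Y x =>
  (ofCoord IM x x).toLinearMap ∘ₗ
      (mvfderiv IM (fun y => toCoord IM x y (Y y)) x).toLinearMap +
    christoffel IM x (Y x)

end Connections

/-! ### Geometry of an isometric immersion `φ : L → M` -/

section Submanifold

variable {EL : Type*} [NormedAddCommGroup EL] [NormedSpace ℝ EL] [FiniteDimensional ℝ EL]
  {HL : Type*} [TopologicalSpace HL] {IL : ModelWithCorners ℝ EL HL}
  {L : Type*} [TopologicalSpace L] [ChartedSpace HL L] [IsManifold IL ∞ L]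
  [RiemannianBundle (fun p : L => TangentSpace IL p)]
  {EM : Type*} [NormedAddCommGroup EM] [NormedSpace ℝ EM] [FiniteDimensional ℝ EM]
  {HM : Type*} [TopologicalSpace HM] {IM : ModelWithCorners ℝ EM HM}
  {M : Type*} [TopologicalSpace M] [ChartedSpace HM M] [IsManifold IM ∞ M]
  [RiemannianBundle (fun x : M => TangentSpace IM x)]
  (φ : C^∞⟮IL, L; IM, M⟯)

/-- The differential `T_p L → T_{φ(p)} M`. -/
def diff (p : L) : TangentSpace IL p →ₗ[ℝ] TangentSpace IM (φ p) :=
  (mfderiv IL IM φ p).toLinearMap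

/-- The smooth map `φ` is an isometric immersion. -/
def IsIsometricImmersion : Prop :=
  ∀ (p : L) (X Y : TangentSpace IL p), ⟪diff φ p X, diff φ p Y⟫ = ⟪X, Y⟫

/-- The tangential component `w^⊤`, as an element of `T_p L`: the adjoint of the isometric
embedding `T_p L → T_{φ(p)} M`. -/
def tang (p : L) : TangentSpace IM (φ p) →ₗ[ℝ] TangentSpace IL p :=
  LinearMap.adjoint (diff φ p)

/-- The normal component `w^⊥`. -/
def nor (p : L) : TangentSpace IM (φ p) →ₗ[ℝ] TangentSpace IM (φ p) :=
  LinearMap.id - diff φ p ∘ₗ tang φ p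

/-- The connection on `TM|L = φ⁻¹ TM` induced by the Levi-Civita connection of `M`. -/
def connAlong (V : ∀ p : L, TangentSpace IM (φ p)) (p : L) :
    TangentSpace IL p →ₗ[ℝ] TangentSpace IM (φ p) :=
  pullbackConnection IL (leviCivita IM) φ Set.univ V p

/-- The induced connection `∇^⊤_X Y = (∇_X Y)^⊤` in `TL`. -/
def connTang : ConnectionOn IL L := fun Y p =>
  tang φ p ∘ₗ connAlong φ (fun p' => diff φ p' (Y p')) p

/-- The induced connection `∇^⊥_X V = (∇_X V)^⊥` in `T^⊥ L`. -/
def connNor (V : ∀ p : L, TangentSpace IM (φ p)) (p : L) :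
    TangentSpace IL p →ₗ[ℝ] TangentSpace IM (φ p) :=
  nor φ p ∘ₗ connAlong φ V p

/-- A local section of the normal bundle extending the normal vector `w` at `p`. -/
def normalExt (p : L) (w : TangentSpace IM (φ p)) (p' : L) : TangentSpace IM (φ p') :=
  nor φ p' (coordField IM (φ p) w (φ p'))

/-- The shape operator `A^w X = - (∇_X w)^⊤` of a normal vector `w` at `p`
(it does not depend on the normal field that extends `w`). -/
def shape (p : L) (w : TangentSpace IM (φ p)) : Module.End ℝ (TangentSpace IL p) :=
  -(tang φ p ∘ₗ connAlong φ (normalExt φ p w) p)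

/-! ### The bundle of orthonormal frames of the normal bundle -/

variable (q : ℕ)

/-- The bundle over `M` with fibre `Hom(ℝ^q, T_x M)`; `f` encodes the `q`-tuple of vectors
`f ε₁, …, f ε_q`, where `ε_α` is the standard basis of `ℝ^q`. -/
abbrev TupleFibre (IM : ModelWithCorners ℝ EM HM) (M : Type*) [TopologicalSpace M]
    [ChartedSpace HM M] : M → Type _ :=
  fun x => Bundle.Trivial M (EuclideanSpace ℝ (Fin q)) x →L[ℝ] TangentSpace IM x

/-- The manifold of all `(p, e₁, …, e_q)` with `p ∈ L` and `e_α ∈ T_{φ(p)} M`: the total space of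
the pull-back to `L` of the bundle of `q`-tuples of tangent vectors of `M`. -/
abbrev Tuples : Type _ :=
  TotalSpace (EuclideanSpace ℝ (Fin q) →L[ℝ] EM) ((φ : L → M) *ᵖ (TupleFibre q IM M))

/-- The model with corners of `Tuples φ q`. -/
abbrev tuplesModel (IL : ModelWithCorners ℝ EL HL) (EM : Type*) [NormedAddCommGroup EM]
    [NormedSpace ℝ EM] : ModelWithCorners ℝ (EL × (EuclideanSpace ℝ (Fin q) →L[ℝ] EM))
      (ModelProd HL (EuclideanSpace ℝ (Fin q) →L[ℝ] EM)) :=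
  IL.prod 𝓘(ℝ, EuclideanSpace ℝ (Fin q) →L[ℝ] EM)

variable {q}

/-- The vector `e_α` of `(p, e₁, …, e_q)`. -/
def Tuples.vec (x : Tuples φ q) (α : Fin q) : TangentSpace IM (φ x.proj) :=
  (show TupleFibre q IM M (φ x.proj) from x.2) (EuclideanSpace.single α (1 : ℝ))

variable (q)

/-- The bundle `O(T^⊥ L)` of orthonormal frames of the normal bundle. -/
def orthonormalFrames : Set (Tuples φ q) :=
  {x | Orthonormal ℝ (Tuples.vec φ x) ∧
    ∀ (α : Fin q) (X : TangentSpace IL x.proj), ⟪Tuples.vec φ x α, diff φ x.proj X⟫ = 0}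

variable {q}

/-- `P` is the bundle `SO(T^⊥ L)` of oriented orthonormal frames for some transversal orientation
of `L`, that is, a reduction of `O(T^⊥ L)` to the group `SO(q)`. -/
def IsOrientedFrameBundle (P : Set (Tuples φ q)) : Prop :=
  (∃ U : Set (Tuples φ q), IsOpen U ∧ P = orthonormalFrames φ q ∩ U) ∧
  ∀ p : L, ∃ f : ((φ : L → M) *ᵖ (TupleFibre q IM M)) p, ⟨p, f⟩ ∈ P ∧
    ∀ f' : ((φ : L → M) *ᵖ (TupleFibre q IM M)) p, ⟨p, f'⟩ ∈ P ↔
      ⟨p, f'⟩ ∈ orthonormalFrames φ q ∧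
        Matrix.det (Matrix.of fun α β : Fin q =>
          (⟪(Tuples.vec φ ⟨p, f⟩ α : TangentSpace IM (φ p)),
            (Tuples.vec φ ⟨p, f'⟩ β : TangentSpace IM (φ p))⟫ : ℝ)) = 1

/-- `P = O(T^⊥ L)`, or `P = SO(T^⊥ L)` for a transversal orientation of `L`. -/
def IsNormalFrameBundle (P : Set (Tuples φ q)) : Prop :=
  P = orthonormalFrames φ q ∨ IsOrientedFrameBundle φ P

/-- The horizontal space at `x = (p, e) ∈ P` of the connection induced by `∇^⊥`: all vectors
`s_* X`, where `X ∈ T_p L` and `s = (s_1, …, s_q)` is a local section of `P` with `s(p) = e` and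
`∇^⊥_X s_α = 0` for all `α`. -/
def horizontalSpace (P : Set (Tuples φ q)) (x : Tuples φ q) :
    Set (TangentSpace (tuplesModel q IL EM) x) :=
  {ξ | ∃ (X : TangentSpace IL x.proj)
      (s : ∀ p : L, ((φ : L → M) *ᵖ (TupleFibre q IM M)) p),
    (∀ᶠ p in 𝓝 x.proj, (⟨p, s p⟩ : Tuples φ q) ∈ P) ∧
    ContMDiffAt IL (tuplesModel q IL EM) ∞ (fun p => (⟨p, s p⟩ : Tuples φ q)) x.proj ∧
    s x.proj = x.2 ∧
    (∀ α, connNor φ (fun p => Tuples.vec φ ⟨p, s p⟩ α) x.proj X = 0) ∧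
    ξ = mfderiv IL (tuplesModel q IL EM) (fun p => (⟨p, s p⟩ : Tuples φ q)) x.proj X}

/-- The horizontal lift `X^h` at `x = (p, e) ∈ P` of `X ∈ T_p L`: the horizontal vector that
projects to `X`. -/
def horizontalLift (P : Set (Tuples φ q)) (x : Tuples φ q) (X : TangentSpace IL x.proj) :
    TangentSpace (tuplesModel q IL EM) x :=
  Classical.epsilon fun ξ => ξ ∈ horizontalSpace φ P x ∧
    mfderiv (tuplesModel q IL EM) IL (fun y : Tuples φ q => y.proj) x ξ = X

/-! ### The bundle `E = π_P⁻¹ TL` over `P`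

A section of `E` (or of `End(E)`) is given as a function on `Tuples φ q`, of which only the values
on `P` matter. -/

/-- `Y ∈ Γ(E)`: the section `Y` of `E` is smooth on `P`. -/
def IsSmoothSection (P : Set (Tuples φ q)) (Y : ∀ x : Tuples φ q, TangentSpace IL x.proj) : Prop :=
  ContMDiffOn (tuplesModel q IL EM) IL.tangent ∞
    (fun x => (⟨x.proj, Y x⟩ : TangentBundle IL L)) P

/-- The connection `∇^E` in `E`, the pull-back of `∇^⊤` along the projection of `P`. -/
def connE (P : Set (Tuples φ q)) (Y : ∀ x : Tuples φ q, TangentSpace IL x.proj)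
    (x : Tuples φ q) : TangentSpace (tuplesModel q IL EM) x →ₗ[ℝ] TangentSpace IL x.proj :=
  pullbackConnection (tuplesModel q IL EM) (connTang φ) (fun y : Tuples φ q => y.proj) P Y x

/-- The connection in `End(E)`: `(∇^E_ξ T) v = ∇^E_ξ (T V) - T (∇^E_ξ V)`, where `V` is a section
of `E` extending `v`. -/
def connEnd (P : Set (Tuples φ q)) (T : ∀ x : Tuples φ q, Module.End ℝ (TangentSpace IL x.proj))
    (x : Tuples φ q) (ξ : TangentSpace (tuplesModel q IL EM) x) (v : TangentSpace IL x.proj) :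
    TangentSpace IL x.proj :=
  connE φ P (fun y => T y (coordField IL x.proj v y.proj)) x ξ -
    T x (connE φ P (fun y => coordField IL x.proj v y.proj) x ξ)

/-- The divergence `div_E W = ∑ᵢ g(∇^E_{eᵢ^h} W, eᵢ)` of a section of `E`. -/
def divE (P : Set (Tuples φ q)) (W : ∀ x : Tuples φ q, TangentSpace IL x.proj)
    (x : Tuples φ q) : ℝ :=
  ∑ i, ⟪connE φ P W x (horizontalLift φ P x (stdOrthonormalBasis ℝ (TangentSpace IL x.proj) i)),
    stdOrthonormalBasis ℝ (TangentSpace IL x.proj) i⟫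

/-- The divergence `div_E T = ∑ᵢ (∇^E_{eᵢ^h} T) eᵢ` of a section of `End(E)`. -/
def divEnd (P : Set (Tuples φ q)) (T : ∀ x : Tuples φ q, Module.End ℝ (TangentSpace IL x.proj))
    (x : Tuples φ q) : TangentSpace IL x.proj :=
  ∑ i, connEnd φ P T x
    (horizontalLift φ P x (stdOrthonormalBasis ℝ (TangentSpace IL x.proj) i))
    (stdOrthonormalBasis ℝ (TangentSpace IL x.proj) i)

/-- The generalized Newton transformation `T_u` of the system of shape operators
`A_α(p, e) = A^{e_α}`, a section of `End(E)`. -/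
def newtonE (u : Fin q →₀ ℕ) (x : Tuples φ q) : Module.End ℝ (TangentSpace IL x.proj) :=
  newton (fun α => shape φ x.proj (Tuples.vec φ x α)) u

end Submanifold

end

/-!
The formula is the Leibniz rule `∇^E_ξ (TY) = (∇^E_ξ T) Y + T (∇^E_ξ Y)` for `T = T_u`, traced over
horizontal lifts `ξ = e_i^h` (`connE_end_apply`). The two terms are brought into the desired form as
follows.

* `T_u` is selfadjoint, and so is its covariant derivative, because `∇^⊤` is metric
  (`inner_connEnd_symm`). Hence `∑ g((∇^E_{e_i^h} T_u) Y, e_i) = g(div_E T_u, Y)`.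
* Put `B X = ∇^E_{X^h} Y`. Since the horizontal lift is linear (`isLinearMap_horizontalLift`), `B`
  is an endomorphism, and `∑ g(T_u B e_i, e_i) = tr(T_u B) = tr(B T_u) = ∑ g(B T_u e_i, e_i)`, in any
  orthonormal bases.

Selfadjointness of `T_u` rests on two facts. The shape operators are selfadjoint
(`shape_isSymmetric`), as the second fundamental form is symmetric. The transformations `T_u` are
the coefficients of the adjugate of `I + ∑ t_α A_α` (`toMatrix_newton`), so that the recursion holds
with the factors in either order (`newton_eq_sub_sum_mul`), and taking adjoints exchanges the two forms.

Horizontal vectors are, by definition, derivatives `s_* X` of local sections `s` of `P` with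
`∇^⊥_X s_α = 0`. Then `∇_X s_α = -A^{s_α} X`, so that `s_* X` is determined by `X`, linearly
(`mvfderiv_fibreCoord_mfderiv_section`). For existence, each vector of the frame is extended to a
normal field that is parallel in the direction `X` (`exists_normal_field_connNor_eq_zero`), and the
fields are made orthonormal by the inverse square root of their Gram matrix. This does not affect
parallelism, since the Gram matrix is stationary in the direction `X`
(`exists_orthonormal_frame_of_orthonormal`). Along such a section `s` the connection `∇^E` becomes
`∇^⊤` (`connE_mfderiv_section`), which reduces statements about `E` to statements on `L`.

The connections are defined at each point by the preferred chart at that point. Their smooth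
dependence on the point, needed to differentiate `T_u`, comes from their expression in a fixed chart
(`connAlong_eq_of_chart`, `inner_leviCivita_ofCoord`).
-/

open Bundle Filter Topology Manifold
open scoped ContDiff RealInnerProductSpace

noncomputable section

/-! ### Tangent vectors and sections in charts -/

section Coordinates

variable {EM : Type*} [NormedAddCommGroup EM] [NormedSpace ℝ EM]
  {HM : Type*} [TopologicalSpace HM] {IM : ModelWithCorners ℝ EM HM}
  {M : Type*} [TopologicalSpace M] [ChartedSpace HM M] [IsManifold IM ∞ M]
  {EN : Type*} [NormedAddCommGroup EN] [NormedSpace ℝ EN]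
  {HN : Type*} [TopologicalSpace HN] {IN : ModelWithCorners ℝ EN HN}
  {N : Type*} [TopologicalSpace N] [ChartedSpace HN N]

theorem toCoord_ofCoord {c x : M} (hx : x ∈ (chartAt HM c).source) (v : EM) :
    toCoord IM c x (ofCoord IM c x v) = v :=
  (trivializationAt EM (TangentSpace IM : M → Type _) c).continuousLinearMapAt_symmL
    (R := ℝ) (by simpa using hx) v

theorem ofCoord_toCoord {c x : M} (hx : x ∈ (chartAt HM c).source) (v : TangentSpace IM x) :
    ofCoord IM c x (toCoord IM c x v) = v :=
  (trivializationAt EM (TangentSpace IM : M → Type _) c).symmL_continuousLinearMapAt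
    (R := ℝ) (by simpa using hx) v

theorem eventually_mem_chartAt_source {b : N → M} {S : Set N} {x : N} {c : M}
    (hb : ContinuousWithinAt b S x) (hx : b x ∈ (chartAt HM c).source) :
    ∀ᶠ y in 𝓝[S] x, b y ∈ (chartAt HM c).source :=
  hb ((chartAt HM c).open_source.mem_nhds hx)

theorem trivializationAt_snd_eq_toCoord {c x : M} (hx : x ∈ (chartAt HM c).source)
    (v : TangentSpace IM x) :
    (trivializationAt EM (TangentSpace IM : M → Type _) c (⟨x, v⟩ : TangentBundle IM M)).2 =
      toCoord IM c x v := by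
  have h : x ∈ (trivializationAt EM (TangentSpace IM : M → Type _) c).baseSet := by
    simpa using hx
  exact ((trivializationAt EM (TangentSpace IM : M → Type _) c).coe_linearMapAt_of_mem
    (R := ℝ) h ▸ rfl)

/-- Smoothness of a section of `b⁻¹ TM`, tested on its components in any chart around `b x`. -/
theorem contMDiffWithinAt_section_iff_toCoord {b : N → M} {V : ∀ y, TangentSpace IM (b y)}
    {S : Set N} {x : N} {c : M} (hx : b x ∈ (chartAt HM c).source) :
    ContMDiffWithinAt IN IM.tangent ∞ (fun y => (⟨b y, V y⟩ : TangentBundle IM M)) S x ↔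
      ContMDiffWithinAt IN IM ∞ b S x ∧
        ContMDiffWithinAt IN 𝓘(ℝ, EM) ∞ (fun y => toCoord IM c (b y) (V y)) S x := by
  rw [(trivializationAt EM (TangentSpace IM : M → Type _) c).contMDiffWithinAt_iff
    (by simpa [Trivialization.mem_source] using hx)]
  refine and_congr_right fun hb => ?_
  refine Filter.EventuallyEq.contMDiffWithinAt_iff ?_ (trivializationAt_snd_eq_toCoord hx _)
  filter_upwards [eventually_mem_chartAt_source hb.continuousWithinAt hx] with y hy
  exact trivializationAt_snd_eq_toCoord hy _

theorem toCoord_coordField {c x : M} (hx : x ∈ (chartAt HM c).source) (v : TangentSpace IM c) :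
    toCoord IM c x (coordField IM c v x) = toCoord IM c c v :=
  toCoord_ofCoord hx _

theorem coordField_self (c : M) (v : TangentSpace IM c) : coordField IM c v c = v :=
  ofCoord_toCoord (mem_chart_source HM c) v

theorem ContMDiffAt.mdifferentiableAt_toCoord {b : N → M} {V : ∀ y, TangentSpace IM (b y)}
    {x : N} {c : M} (hc : b x ∈ (chartAt HM c).source)
    (hV : ContMDiffAt IN IM.tangent ∞ (fun y => (⟨b y, V y⟩ : TangentBundle IM M)) x) :
    MDifferentiableAt IN 𝓘(ℝ, EM) (fun y => toCoord IM c (b y) (V y)) x :=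
  ContMDiffAt.mdifferentiableAt
    ((contMDiffWithinAt_section_iff_toCoord (S := Set.univ) hc).1 hV).2 (by simp)

theorem ContMDiffWithinAt.section_ofCoord {b : N → M} {v : N → EM} {S : Set N} {x : N} {c : M}
    (hx : b x ∈ (chartAt HM c).source) (hb : ContMDiffWithinAt IN IM ∞ b S x)
    (hv : ContMDiffWithinAt IN 𝓘(ℝ, EM) ∞ v S x) :
    ContMDiffWithinAt IN IM.tangent ∞
      (fun y => (⟨b y, ofCoord IM c (b y) (v y)⟩ : TangentBundle IM M)) S x := by
  refine (contMDiffWithinAt_section_iff_toCoord hx).2 ⟨hb, ?_⟩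
  refine hv.congr_of_eventuallyEq ?_ (toCoord_ofCoord hx _)
  filter_upwards [eventually_mem_chartAt_source hb.continuousWithinAt hx] with y hy
  exact toCoord_ofCoord hy _

theorem contMDiffAt_section_ofCoord {c x : M} (hx : x ∈ (chartAt HM c).source) (v : EM) :
    ContMDiffAt IM IM.tangent ∞ (fun y => (⟨y, ofCoord IM c y v⟩ : TangentBundle IM M)) x :=
  ContMDiffWithinAt.section_ofCoord (b := id) hx contMDiffWithinAt_id contMDiffWithinAt_const

theorem contMDiffWithinAt_clm_of_apply {E F : Type*} [NormedAddCommGroup E] [NormedSpace ℝ E]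
    [FiniteDimensional ℝ E] [NormedAddCommGroup F] [NormedSpace ℝ F] {f : N → E →L[ℝ] F}
    {S : Set N} {x : N} (hf : ∀ v, ContMDiffWithinAt IN 𝓘(ℝ, F) ∞ (fun y => f y v) S x) :
    ContMDiffWithinAt IN 𝓘(ℝ, E →L[ℝ] F) ∞ f S x := by
  set b := Module.finBasis ℝ E
  have h1 : f = fun y => ∑ i, ContinuousLinearMap.smulRightL ℝ E F
      (b.coord i).toContinuousLinearMap (f y (b i)) := by
    funext y
    ext v
    conv_lhs => rw [← b.sum_repr v, map_sum]
    simp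
  rw [h1]
  refine contMDiffWithinAt_finsetSum fun i _ => ?_
  exact (ContinuousLinearMap.contMDiff _).contMDiffAt.comp_contMDiffWithinAt x (hf (b i))

theorem ContMDiffWithinAt.inner_section [FiniteDimensional ℝ EM]
    [RiemannianBundle (fun x : M => TangentSpace IM x)]
    [IsContMDiffRiemannianBundle IM ∞ EM (fun x : M => TangentSpace IM x)]
    {b : N → M} {V W : ∀ y, TangentSpace IM (b y)} {S : Set N} {x : N}
    (hV : ContMDiffWithinAt IN IM.tangent ∞ (fun y => (⟨b y, V y⟩ : TangentBundle IM M)) S x)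
    (hW : ContMDiffWithinAt IN IM.tangent ∞ (fun y => (⟨b y, W y⟩ : TangentBundle IM M)) S x) :
    ContMDiffWithinAt IN 𝓘(ℝ, ℝ) ∞ (fun y => (⟪V y, W y⟫ : ℝ)) S x :=
  ContMDiffWithinAt.inner_bundle (E := fun x : M => TangentSpace IM x) (F := EM) (IB := IM)
    (b := b) (v := V) (w := W) hV hW

variable (IM) in
theorem contMDiffAt_metricCoord [FiniteDimensional ℝ EM]
    [RiemannianBundle (fun x : M => TangentSpace IM x)]
    [IsContMDiffRiemannianBundle IM ∞ EM (fun x : M => TangentSpace IM x)] {c x : M}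
    (hx : x ∈ (chartAt HM c).source) :
    ContMDiffAt IM 𝓘(ℝ, EM →L[ℝ] EM →L[ℝ] ℝ) ∞ (metricCoord IM c) x := by
  have h (v : EM) : ContMDiffWithinAt IM IM.tangent ∞
      (fun y => (⟨y, ofCoord IM c y v⟩ : TangentBundle IM M)) Set.univ x :=
    ContMDiffWithinAt.section_ofCoord (b := id) hx contMDiffWithinAt_id contMDiffWithinAt_const
  exact contMDiffWithinAt_clm_of_apply fun v => contMDiffWithinAt_clm_of_apply fun w =>
    ContMDiffWithinAt.inner_section (h v) (h w)

theorem ContMDiffWithinAt.section_mfderiv [IsManifold IN ∞ N] {P HP EP : Type*}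
    [NormedAddCommGroup EP] [NormedSpace ℝ EP] [TopologicalSpace HP]
    {IP : ModelWithCorners ℝ EP HP} [TopologicalSpace P] [ChartedSpace HP P]
    {f : N → M} (hf : ContMDiff IN IM ∞ f) {b : P → N}
    {Y : ∀ p, TangentSpace IN (b p)} {S : Set P} {x : P}
    (hY : ContMDiffWithinAt IP IN.tangent ∞ (fun y => (⟨b y, Y y⟩ : TangentBundle IN N)) S x) :
    ContMDiffWithinAt IP IM.tangent ∞
      (fun p => (⟨f (b p), mfderiv IN IM f (b p) (Y p)⟩ : TangentBundle IM M)) S x :=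
  ((hf.contMDiff_tangentMap (m := ∞) le_rfl).contMDiffAt).comp_contMDiffWithinAt x hY

/-- The components of `dg` in the preferred chart at `c` are smooth. -/
theorem ContMDiffAt.mvfderiv_comp_ofCoord {F : Type*} [NormedAddCommGroup F] [NormedSpace ℝ F]
    {g : M → F} {c : M} (hg : ContMDiffAt IM 𝓘(ℝ, F) ∞ g c) :
    ContMDiffAt IM 𝓘(ℝ, EM →L[ℝ] F) ∞ (fun y => mvfderiv IM g y ∘L ofCoord IM c y) c := by
  have h := hg.mfderiv_const (m := ∞) le_rfl
  refine h.congr_of_eventuallyEq ?_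
  filter_upwards [(chartAt HM c).open_source.mem_nhds (mem_chart_source HM c)] with y hy
  ext v
  rw [inTangentCoordinates_eq_mfderiv_comp (f := id) hy
    (by rw [chartAt_self_eq]; trivial)]
  rw [ofCoord, TangentBundle.symmL_trivializationAt hy]
  rw [show mfderiv 𝓘(ℝ, F) 𝓘(ℝ, F) (extChartAt 𝓘(ℝ, F) (g c)) (g y) =
    ContinuousLinearMap.id ℝ F by
      rw [extChartAt_model_space_eq_id]; exact mfderiv_id]
  rfl

end Coordinates

section Sections

variable {EN : Type*} [NormedAddCommGroup EN] [NormedSpace ℝ EN]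
  {HN : Type*} [TopologicalSpace HN] {IN : ModelWithCorners ℝ EN HN}
  {N : Type*} [TopologicalSpace N] [ChartedSpace HN N]
  {EM : Type*} [NormedAddCommGroup EM] [NormedSpace ℝ EM]
  {HM : Type*} [TopologicalSpace HM] {IM : ModelWithCorners ℝ EM HM}
  {M : Type*} [TopologicalSpace M] [ChartedSpace HM M] [IsManifold IM ∞ M]
  {b : N → M} {V W : ∀ n, TangentSpace IM (b n)} {S : Set N} {x : N}

theorem ContMDiffWithinAt.section_add
    (hV : ContMDiffWithinAt IN IM.tangent ∞ (fun n => (⟨b n, V n⟩ : TangentBundle IM M)) S x)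
    (hW : ContMDiffWithinAt IN IM.tangent ∞ (fun n => (⟨b n, W n⟩ : TangentBundle IM M)) S x) :
    ContMDiffWithinAt IN IM.tangent ∞ (fun n => (⟨b n, V n + W n⟩ : TangentBundle IM M)) S x := by
  have hc := mem_chart_source HM (b x)
  rw [contMDiffWithinAt_section_iff_toCoord hc] at hV hW ⊢
  simp only [map_add]
  exact ⟨hV.1, hV.2.add hW.2⟩

theorem ContMDiffWithinAt.section_sub
    (hV : ContMDiffWithinAt IN IM.tangent ∞ (fun n => (⟨b n, V n⟩ : TangentBundle IM M)) S x)
    (hW : ContMDiffWithinAt IN IM.tangent ∞ (fun n => (⟨b n, W n⟩ : TangentBundle IM M)) S x) :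
    ContMDiffWithinAt IN IM.tangent ∞ (fun n => (⟨b n, V n - W n⟩ : TangentBundle IM M)) S x := by
  have hc := mem_chart_source HM (b x)
  rw [contMDiffWithinAt_section_iff_toCoord hc] at hV hW ⊢
  simp only [map_sub]
  exact ⟨hV.1, hV.2.sub hW.2⟩

theorem ContMDiffWithinAt.section_smul {f : N → ℝ} (hf : ContMDiffWithinAt IN 𝓘(ℝ, ℝ) ∞ f S x)
    (hV : ContMDiffWithinAt IN IM.tangent ∞ (fun n => (⟨b n, V n⟩ : TangentBundle IM M)) S x) :
    ContMDiffWithinAt IN IM.tangent ∞ (fun n => (⟨b n, f n • V n⟩ : TangentBundle IM M)) S x := by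
  have hc := mem_chart_source HM (b x)
  rw [contMDiffWithinAt_section_iff_toCoord hc] at hV ⊢
  simp only [map_smul]
  exact ⟨hV.1, hf.smul hV.2⟩

theorem contMDiffWithinAt_section_zero (hb : ContMDiffWithinAt IN IM ∞ b S x) :
    ContMDiffWithinAt IN IM.tangent ∞
      (fun n => (⟨b n, 0⟩ : TangentBundle IM M)) S x := by
  rw [contMDiffWithinAt_section_iff_toCoord (V := fun n => (0 : TangentSpace IM (b n)))
    (mem_chart_source HM (b x))]
  simp only [map_zero]
  exact ⟨hb, contMDiffWithinAt_const⟩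

end Sections

/-! ### Derivatives of vector-valued functions -/

section VectorValued

variable {EN : Type*} [NormedAddCommGroup EN] [NormedSpace ℝ EN]
  {HN : Type*} [TopologicalSpace HN] {IN : ModelWithCorners ℝ EN HN}
  {N : Type*} [TopologicalSpace N] [ChartedSpace HN N]
  {EM : Type*} [NormedAddCommGroup EM] [NormedSpace ℝ EM]
  {HM : Type*} [TopologicalSpace HM] {IM : ModelWithCorners ℝ EM HM}
  {M : Type*} [TopologicalSpace M] [ChartedSpace HM M]
  {E F : Type*} [NormedAddCommGroup E] [NormedSpace ℝ E] [NormedAddCommGroup F] [NormedSpace ℝ F]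

theorem Filter.EventuallyEq.mvfderiv_eq {f g : N → F} {x : N} (h : f =ᶠ[𝓝 x] g) :
    mvfderiv IN f x = mvfderiv IN g x := by
  ext v
  exact congrArg (fun A : EN →L[ℝ] F => A v) h.mfderiv_eq

theorem mvfderiv_clm_apply {g : N → E →L[ℝ] F} {f : N → E} {x : N}
    (hg : MDifferentiableAt IN 𝓘(ℝ, E →L[ℝ] F) g x) (hf : MDifferentiableAt IN 𝓘(ℝ, E) f x)
    (ξ : TangentSpace IN x) :
    mvfderiv IN (fun y => g y (f y)) x ξ =
      mvfderiv IN g x ξ (f x) + g x (mvfderiv IN f x ξ) := by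
  have hu : UniqueDiffWithinAt ℝ (Set.range IN) (extChartAt IN x x) :=
    IN.uniqueDiffOn _ (Set.mem_range_self _)
  have hg' := hg.differentiableWithinAt_writtenInExtChartAt
  have hf' := hf.differentiableWithinAt_writtenInExtChartAt
  rw [(hg.clm_apply hf).mvfderiv, hg.mvfderiv, hf.mvfderiv]
  have := congrArg (fun A : EN →L[ℝ] F => A ξ) (fderivWithin_clm_apply hu hg' hf')
  simp [writtenInExtChartAt, Function.comp_def] at this ⊢
  rw [add_comm]
  exact this

theorem mvfderiv_clm_const_apply (A : E →L[ℝ] F) {f : N → E} {x : N}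
    (hf : MDifferentiableAt IN 𝓘(ℝ, E) f x) (ξ : TangentSpace IN x) :
    mvfderiv IN (fun y => A (f y)) x ξ = A (mvfderiv IN f x ξ) := by
  rw [mvfderiv_clm_apply mdifferentiableAt_const hf, mvfderiv_const]
  simp

theorem mvfderiv_clm_apply_const {g : N → E →L[ℝ] F} {x : N}
    (hg : MDifferentiableAt IN 𝓘(ℝ, E →L[ℝ] F) g x) (v : E) (ξ : TangentSpace IN x) :
    mvfderiv IN (fun y => g y v) x ξ = mvfderiv IN g x ξ v := by
  rw [mvfderiv_clm_apply hg mdifferentiableAt_const, mvfderiv_const]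
  simp

theorem mvfderiv_comp_apply' {f : N → M} {g : M → F} (x : N)
    (hg : MDifferentiableAt IM 𝓘(ℝ, F) g (f x)) (hf : MDifferentiableAt IN IM f x)
    (ξ : TangentSpace IN x) :
    mvfderiv IN (fun y => g (f y)) x ξ = mvfderiv IM g (f x) (mfderiv IN IM f x ξ) :=
  mfderiv_comp_apply x hg hf ξ

end VectorValued

/-! ### The Levi-Civita connection and the connection along a map -/

section LeviCivita

variable {EM : Type*} [NormedAddCommGroup EM] [NormedSpace ℝ EM] [FiniteDimensional ℝ EM]
  {HM : Type*} [TopologicalSpace HM] {IM : ModelWithCorners ℝ EM HM}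
  {M : Type*} [TopologicalSpace M] [ChartedSpace HM M] [IsManifold IM ∞ M]
  [RiemannianBundle (fun x : M => TangentSpace IM x)]

variable (IM) in
theorem metricDeriv_symm [IsContMDiffRiemannianBundle IM ∞ EM (fun x : M => TangentSpace IM x)]
    (c : M) (u v w : TangentSpace IM c) :
    metricDeriv IM c u v w = metricDeriv IM c u w v := by
  have hd : MDifferentiableAt IM 𝓘(ℝ, EM →L[ℝ] EM →L[ℝ] ℝ) (metricCoord IM c) c :=
    (contMDiffAt_metricCoord IM (mem_chart_source HM c)).mdifferentiableAt (by simp)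
  have h (a b : EM) : mvfderiv IM (fun y => metricCoord IM c y a b) c u =
      mvfderiv IM (metricCoord IM c) c u a b := by
    rw [mvfderiv_clm_apply_const (g := fun y => metricCoord IM c y a)
      (hd.clm_apply mdifferentiableAt_const), mvfderiv_clm_apply_const hd]
  rw [metricDeriv, metricDeriv, ← h, ← h]
  congr 2
  funext y
  exact real_inner_comm (ofCoord IM c y (toCoord IM c c w)) (ofCoord IM c y (toCoord IM c c v))

variable (IM) in
theorem inner_christoffel (c : M) (u v w : TangentSpace IM c) :
    ⟪christoffel IM c v u, w⟫ = (1 / 2 : ℝ) *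
      (metricDeriv IM c u v w + metricDeriv IM c v u w - metricDeriv IM c w u v) := by
  have hadd (a b w w' : TangentSpace IM c) : metricDeriv IM c a b (w + w') =
      metricDeriv IM c a b w + metricDeriv IM c a b w' := by
    simp only [metricDeriv, map_add]
  have hsmul (a b w : TangentSpace IM c) (r : ℝ) : metricDeriv IM c a b (r • w) =
      r * metricDeriv IM c a b w := by
    simp only [metricDeriv, map_smul, smul_eq_mul]
  let lin : TangentSpace IM c →ₗ[ℝ] ℝ :=
    { toFun := fun w => (1 / 2 : ℝ) *
        (metricDeriv IM c u v w + metricDeriv IM c v u w - metricDeriv IM c w u v)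
      map_add' := fun w w' => by rw [hadd, hadd, metricDeriv_add₁]; ring
      map_smul' := fun r w => by
        rw [hsmul, hsmul, metricDeriv_smul₁, RingHom.id_apply, smul_eq_mul]; ring }
  change _ = lin w
  set e := stdOrthonormalBasis ℝ (TangentSpace IM c)
  have h1 : ∀ j, ⟪christoffel IM c v u, e j⟫ = lin (e j) := by
    intro j
    change ⟪∑ i, lin (e i) • e i, e j⟫ = lin (e j)
    simp [sum_inner, inner_smul_left, e.inner_eq_ite]
  rw [← e.sum_repr w, inner_sum, map_sum]
  simp only [inner_smul_right, h1, map_smul, smul_eq_mul]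

variable (IM) in
theorem christoffel_symm [IsContMDiffRiemannianBundle IM ∞ EM (fun x : M => TangentSpace IM x)]
    (c : M) (u v : TangentSpace IM c) : christoffel IM c v u = christoffel IM c u v := by
  refine ext_inner_right ℝ fun w => ?_
  rw [inner_christoffel, inner_christoffel, metricDeriv_symm IM c w u v]
  ring

variable (IM) in
/-- The Christoffel symbols are compatible with the metric. -/
theorem inner_christoffel_add_inner_christoffel
    [IsContMDiffRiemannianBundle IM ∞ EM (fun x : M => TangentSpace IM x)]
    (c : M) (u v w : TangentSpace IM c) :
    ⟪christoffel IM c v u, w⟫ + ⟪v, christoffel IM c w u⟫ = metricDeriv IM c u v w := by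
  rw [real_inner_comm _ v, inner_christoffel, inner_christoffel, metricDeriv_symm IM c u w v,
    metricDeriv_symm IM c v u w, metricDeriv_symm IM c w u v]
  ring

theorem leviCivita_coordField (c : M) (v : TangentSpace IM c) :
    leviCivita IM (coordField IM c v) c = christoffel IM c v := by
  have h : mvfderiv IM (fun y => toCoord IM c y (coordField IM c v y)) c = 0 := by
    rw [Filter.EventuallyEq.mvfderiv_eq (g := fun _ => toCoord IM c c v), mvfderiv_const]
    filter_upwards [(chartAt HM c).open_source.mem_nhds (mem_chart_source HM c)] with y hy
    exact toCoord_coordField hy v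
  ext u
  simp [leviCivita, h, coordField_self]

end LeviCivita

section Along

variable {EL : Type*} [NormedAddCommGroup EL] [NormedSpace ℝ EL]
  {HL : Type*} [TopologicalSpace HL] {IL : ModelWithCorners ℝ EL HL}
  {L : Type*} [TopologicalSpace L] [ChartedSpace HL L]
  {EM : Type*} [NormedAddCommGroup EM] [NormedSpace ℝ EM] [FiniteDimensional ℝ EM]
  {HM : Type*} [TopologicalSpace HM] {IM : ModelWithCorners ℝ EM HM}
  {M : Type*} [TopologicalSpace M] [ChartedSpace HM M] [IsManifold IM ∞ M]
  [RiemannianBundle (fun x : M => TangentSpace IM x)]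
  (φ : C^∞⟮IL, L; IM, M⟯)

theorem connAlong_apply (V : ∀ p : L, TangentSpace IM (φ p)) (p : L) (X : TangentSpace IL p) :
    connAlong φ V p X = ofCoord IM (φ p) (φ p)
        (mvfderiv IL (fun p' => toCoord IM (φ p) (φ p') (V p')) p X) +
      christoffel IM (φ p) (V p) (diff φ p X) := by
  simp [connAlong, pullbackConnection, leviCivita_coordField, diff]

variable {φ}

theorem connAlong_add {V W : ∀ p : L, TangentSpace IM (φ p)} {p : L}
    (hV : ContMDiffAt IL IM.tangent ∞ (fun p => (⟨φ p, V p⟩ : TangentBundle IM M)) p)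
    (hW : ContMDiffAt IL IM.tangent ∞ (fun p => (⟨φ p, W p⟩ : TangentBundle IM M)) p)
    [IsContMDiffRiemannianBundle IM ∞ EM (fun x : M => TangentSpace IM x)]
    (X : TangentSpace IL p) :
    connAlong φ (fun p => V p + W p) p X = connAlong φ V p X + connAlong φ W p X := by
  simp only [connAlong_apply, map_add, christoffel_symm IM (φ p) (diff φ p X)]
  rw [mvfderiv_fun_add (hV.mdifferentiableAt_toCoord (mem_chart_source _ _))
    (hW.mdifferentiableAt_toCoord (mem_chart_source _ _))]
  simp
  abel

theorem connAlong_smul {V : ∀ p : L, TangentSpace IM (φ p)} {f : L → ℝ} {p : L}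
    (hf : MDifferentiableAt IL 𝓘(ℝ, ℝ) f p)
    (hV : ContMDiffAt IL IM.tangent ∞ (fun p => (⟨φ p, V p⟩ : TangentBundle IM M)) p)
    [IsContMDiffRiemannianBundle IM ∞ EM (fun x : M => TangentSpace IM x)]
    (X : TangentSpace IL p) :
    connAlong φ (fun p => f p • V p) p X =
      mvfderiv IL f p X • V p + f p • connAlong φ V p X := by
  simp only [connAlong_apply, map_smul, christoffel_symm IM (φ p) (diff φ p X)]
  rw [mvfderiv_fun_smul hf (hV.mdifferentiableAt_toCoord (mem_chart_source _ _))]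
  simp [ofCoord_toCoord (mem_chart_source HM (φ p))]
  abel

/-- The connection along `φ` is metric. -/
theorem mvfderiv_inner_eq_connAlong {V W : ∀ p : L, TangentSpace IM (φ p)} {p : L}
    (hV : ContMDiffAt IL IM.tangent ∞ (fun p => (⟨φ p, V p⟩ : TangentBundle IM M)) p)
    (hW : ContMDiffAt IL IM.tangent ∞ (fun p => (⟨φ p, W p⟩ : TangentBundle IM M)) p)
    [IsContMDiffRiemannianBundle IM ∞ EM (fun x : M => TangentSpace IM x)]
    (X : TangentSpace IL p) :
    mvfderiv IL (fun p => (⟪V p, W p⟫ : ℝ)) p X =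
      ⟪connAlong φ V p X, W p⟫ + ⟪V p, connAlong φ W p X⟫ := by
  have hc := mem_chart_source HM (φ p)
  have hφ : MDifferentiableAt IL IM φ p := φ.contMDiff.mdifferentiableAt (by simp)
  have hV' := hV.mdifferentiableAt_toCoord hc
  have hW' := hW.mdifferentiableAt_toCoord hc
  have hg : MDifferentiableAt IM 𝓘(ℝ, EM →L[ℝ] EM →L[ℝ] ℝ) (metricCoord IM (φ p)) (φ p) :=
    (contMDiffAt_metricCoord IM hc).mdifferentiableAt (by simp)
  have hgφ : MDifferentiableAt IL 𝓘(ℝ, EM →L[ℝ] EM →L[ℝ] ℝ)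
      (fun p' => metricCoord IM (φ p) (φ p')) p := hg.comp p hφ
  have h1 : (fun p => (⟪V p, W p⟫ : ℝ)) =ᶠ[𝓝 p] fun p' => metricCoord IM (φ p) (φ p')
      (toCoord IM (φ p) (φ p') (V p')) (toCoord IM (φ p) (φ p') (W p')) := by
    have := eventually_mem_chartAt_source (S := Set.univ)
      hφ.continuousAt.continuousWithinAt hc
    rw [nhdsWithin_univ] at this
    filter_upwards [this] with p' hp'
    simp [metricCoord, ofCoord_toCoord hp']
  rw [h1.mvfderiv_eq, mvfderiv_clm_apply (hgφ.clm_apply hV') hW', mvfderiv_clm_apply hgφ hV',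
    mvfderiv_comp_apply' p hg hφ]
  simp only [connAlong_apply, inner_add_left, inner_add_right]
  have h2 := inner_christoffel_add_inner_christoffel IM (φ p) (diff φ p X) (V p) (W p)
  simp only [metricDeriv] at h2
  have h3 (a : EM) (w : TangentSpace IM (φ p)) :
      metricCoord IM (φ p) (φ p) a (toCoord IM (φ p) (φ p) w) =
        ⟪(ofCoord IM (φ p) (φ p) a : TangentSpace IM (φ p)), w⟫ := by
    simp [metricCoord, ofCoord_toCoord hc]
  have h4 (a : EM) (w : TangentSpace IM (φ p)) :
      metricCoord IM (φ p) (φ p) (toCoord IM (φ p) (φ p) w) a =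
        ⟪w, (ofCoord IM (φ p) (φ p) a : TangentSpace IM (φ p))⟫ := by
    simp [metricCoord, ofCoord_toCoord hc]
  rw [add_apply, h3, h4]
  change mvfderiv IM (metricCoord IM (φ p)) (φ p) (diff φ p X) _ _ + _ + _ = _
  rw [← h2]
  ring

end Along

/-! ### Symmetry of the second fundamental form -/

section SecondFundamentalForm

variable {EL : Type*} [NormedAddCommGroup EL] [NormedSpace ℝ EL]
  {HL : Type*} [TopologicalSpace HL] {IL : ModelWithCorners ℝ EL HL}
  {L : Type*} [TopologicalSpace L] [ChartedSpace HL L] [IsManifold IL ∞ L]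
  {EM : Type*} [NormedAddCommGroup EM] [NormedSpace ℝ EM]
  {HM : Type*} [TopologicalSpace HM] {IM : ModelWithCorners ℝ EM HM}
  {M : Type*} [TopologicalSpace M] [ChartedSpace HM M] [IsManifold IM ∞ M]
  (φ : C^∞⟮IL, L; IM, M⟯)

/-- Equality of mixed partials: in the charts at `φ p` and `p₀`, both sides are second derivatives
of the coordinate expression of `φ`. -/
theorem mvfderiv_toCoord_mfderiv_symm (p₀ : L) {p : L} (hp : p ∈ (chartAt HL p₀).source)
    (v w : EL) :
    mvfderiv IL (fun p' => toCoord IM (φ p) (φ p') (mfderiv IL IM φ p' (ofCoord IL p₀ p' v))) p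
        (ofCoord IL p₀ p w) =
      mvfderiv IL (fun p' => toCoord IM (φ p) (φ p') (mfderiv IL IM φ p' (ofCoord IL p₀ p' w))) p
        (ofCoord IL p₀ p v) := by
  -- the coordinate expression of `φ`
  set G : EL → EM := extChartAt IM (φ p) ∘ φ ∘ (extChartAt IL p₀).symm with hG
  set z := extChartAt IL p₀ p with hz
  have hpe : p ∈ (extChartAt IL p₀).source := by simpa using hp
  have hzt : z ∈ (extChartAt IL p₀).target := (extChartAt IL p₀).map_source hpe
  have hzr : z ∈ Set.range IL := extChartAt_target_subset_range p₀ hzt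
  have hinv : (extChartAt IL p₀).symm z = p := (extChartAt IL p₀).left_inv hpe
  have hGs : ContDiffWithinAt ℝ ∞ G (Set.range IL) z := by
    rw [← contMDiffWithinAt_iff_contDiffWithinAt]
    have h1 : ContMDiffWithinAt 𝓘(ℝ, EL) IL ∞ (extChartAt IL p₀).symm (Set.range IL) z :=
      contMDiffWithinAt_extChartAt_symm_range p₀ hzt
    have h2 : ContMDiffAt IM 𝓘(ℝ, EM) ∞ (extChartAt IM (φ p)) (φ p) := contMDiffAt_extChartAt
    refine ContMDiffAt.comp_contMDiffWithinAt z ?_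
      (φ.contMDiff.contMDiffAt.comp_contMDiffWithinAt z h1)
    simpa only [Function.comp, hinv] using h2
  have key (v w : EL) : mvfderiv IL
      (fun p' => toCoord IM (φ p) (φ p') (mfderiv IL IM φ p' (ofCoord IL p₀ p' v))) p
        (ofCoord IL p₀ p w) =
      fderivWithin ℝ (fderivWithin ℝ G (Set.range IL)) (Set.range IL) z w v := by
    have hφc : ∀ᶠ z' in 𝓝[Set.range IL] z,
        φ ((extChartAt IL p₀).symm z') ∈ (chartAt HM (φ p)).source := by
      have h1 : ContinuousWithinAt (fun z' => φ ((extChartAt IL p₀).symm z')) (Set.range IL) z :=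
        φ.contMDiff.continuous.continuousAt.comp_continuousWithinAt
          (contMDiffWithinAt_extChartAt_symm_range (I := IL) (n := ∞) p₀ hzt).continuousWithinAt
      exact h1 ((chartAt HM (φ p)).open_source.mem_nhds (by
        change φ ((extChartAt IL p₀).symm z) ∈ _
        rw [hinv]; exact mem_chart_source _ _))
    have hev : (fun z' => toCoord IM (φ p) (φ ((extChartAt IL p₀).symm z'))
        (mfderiv IL IM φ ((extChartAt IL p₀).symm z')
          (ofCoord IL p₀ ((extChartAt IL p₀).symm z') v))) =ᶠ[𝓝[Set.range IL] z]
        fun z' => fderivWithin ℝ G (Set.range IL) z' v := by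
      filter_upwards [hφc, extChartAt_target_mem_nhdsWithin' hpe] with z' hz'c hz't
      have hz's : (extChartAt IL p₀).symm z' ∈ (chartAt HL p₀).source := by
        simpa using (extChartAt IL p₀).map_target hz't
      have d1 :=
        (mdifferentiableWithinAt_extChartAt_symm (I := IL) hz't).hasMFDerivWithinAt
      have d2 := (φ.contMDiff.mdifferentiableAt (x := (extChartAt IL p₀).symm z')
        (by simp)).hasMFDerivAt
      have d3 :=
        (mdifferentiableAt_extChartAt (I := IM) hz'c).hasMFDerivAt
      have d4 := (d3.comp_hasMFDerivWithinAt z' (d2.comp_hasMFDerivWithinAt z' d1))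
      have d5 : HasFDerivWithinAt G (_ : EL →L[ℝ] EM) (Set.range IL) z' :=
        hasMFDerivWithinAt_iff_hasFDerivWithinAt.1 d4
      have d6 := d5.fderivWithin (IL.uniqueDiffOn z' (extChartAt_target_subset_range p₀ hz't))
      have h1 : ∀ z'', z'' = z' → (mfderivWithin 𝓘(ℝ, EL) IL (extChartAt IL p₀).symm
          (Set.range IL) z'' : EL →L[ℝ] EL) = (mfderivWithin 𝓘(ℝ, EL) IL (extChartAt IL p₀).symm
          (Set.range IL) z' : EL →L[ℝ] EL) := by
        rintro _ rfl; rfl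
      have h2 : (ofCoord IL p₀ ((extChartAt IL p₀).symm z') : EL →L[ℝ] EL) =
          mfderivWithin 𝓘(ℝ, EL) IL (extChartAt IL p₀).symm (Set.range IL) z' :=
        (TangentBundle.symmL_trivializationAt hz's).trans
          (h1 _ ((extChartAt IL p₀).right_inv hz't))
      have h3 : toCoord IM (φ p) (φ ((extChartAt IL p₀).symm z')) =
          mfderiv IM 𝓘(ℝ, EM) (extChartAt IM (φ p)) (φ ((extChartAt IL p₀).symm z')) :=
        TangentBundle.continuousLinearMapAt_trivializationAt hz'c
      rw [h3]
      refine Eq.trans ?_ (congrArg (fun A : EL →L[ℝ] EM => A v) d6).symm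
      exact congrArg (fun A : EL →L[ℝ] EL => mfderiv IM 𝓘(ℝ, EM) (extChartAt IM (φ p))
        (φ ((extChartAt IL p₀).symm z')) (mfderiv IL IM φ ((extChartAt IL p₀).symm z') (A v))) h2
    have hf : MDifferentiableAt IL 𝓘(ℝ, EM)
        (fun p' => toCoord IM (φ p) (φ p') (mfderiv IL IM φ p' (ofCoord IL p₀ p' v))) p := by
      refine ContMDiffAt.mdifferentiableAt_toCoord (mem_chart_source _ _) ?_
      exact ContMDiffWithinAt.section_mfderiv (b := id) φ.contMDiff
        (contMDiffAt_section_ofCoord hp v)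
    have hc := mfderiv_comp_mfderivWithin_of_eq (x := z) hf
      (mdifferentiableWithinAt_extChartAt_symm hzt)
      (IL.uniqueDiffOn z hzr).uniqueMDiffWithinAt hinv
    have hG1 : DifferentiableWithinAt ℝ (fderivWithin ℝ G (Set.range IL)) (Set.range IL) z :=
      (hGs.fderivWithin_right (m := 1) IL.uniqueDiffOn
        (by norm_num; exact ENat.LEInfty.out) hzr).differentiableWithinAt
        (by simp)
    have e1 : fderivWithin ℝ (fun z' => fderivWithin ℝ G (Set.range IL) z' v) (Set.range IL) z w =
        fderivWithin ℝ (fderivWithin ℝ G (Set.range IL)) (Set.range IL) z w v := by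
      rw [fderivWithin_clm_apply (IL.uniqueDiffOn z hzr) hG1 (differentiableWithinAt_const _)]
      simp
    rw [← e1, ← hev.fderivWithin_eq_of_mem hzr, ← mfderivWithin_eq_fderivWithin]
    have h2 : (ofCoord IL p₀ p : EL →L[ℝ] EL) =
        mfderivWithin 𝓘(ℝ, EL) IL (extChartAt IL p₀).symm (Set.range IL) z :=
      TangentBundle.symmL_trivializationAt hp
    refine Eq.trans ?_ (congrArg (fun A : EL →L[ℝ] EM => A w) hc).symm
    exact congrArg (fun A : EL →L[ℝ] EL => mvfderiv IL (fun p' => toCoord IM (φ p) (φ p')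
      (mfderiv IL IM φ p' (ofCoord IL p₀ p' v))) p (A w)) h2
  rw [key, key]
  refine (hGs.isSymmSndFDerivWithinAt
    (by simpa using ENat.LEInfty.out) IL.uniqueDiffOn ?_ hzr).eq _ _
  exact IL.range_subset_closure_interior hzr

variable [FiniteDimensional ℝ EM] [RiemannianBundle (fun x : M => TangentSpace IM x)]
  [IsContMDiffRiemannianBundle IM ∞ EM (fun x : M => TangentSpace IM x)]

/-- The connection along `φ` is torsion free. -/
theorem connAlong_mfderiv_ofCoord_symm (p₀ : L) {p : L} (hp : p ∈ (chartAt HL p₀).source)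
    (v w : EL) :
    connAlong φ (fun p' => diff φ p' (ofCoord IL p₀ p' v)) p (ofCoord IL p₀ p w) =
      connAlong φ (fun p' => diff φ p' (ofCoord IL p₀ p' w)) p (ofCoord IL p₀ p v) := by
  rw [connAlong_apply, connAlong_apply, christoffel_symm]
  exact congrArg (fun a => ofCoord IM (φ p) (φ p) a + _) (mvfderiv_toCoord_mfderiv_symm φ p₀ hp v w)

end SecondFundamentalForm

/-! ### The connections in an arbitrary chart -/

section LeviCivitaChart

theorem diff_id_apply {EM : Type*} [NormedAddCommGroup EM] [NormedSpace ℝ EM]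
    {HM : Type*} [TopologicalSpace HM] {IM : ModelWithCorners ℝ EM HM}
    {M : Type*} [TopologicalSpace M] [ChartedSpace HM M] (x : M) (u : TangentSpace IM x) :
    diff (ContMDiffMap.id : C^∞⟮IM, M; IM, M⟯) x u = u :=
  congrArg (fun A : EM →L[ℝ] EM => A u) (mfderiv_id (I := IM) (x := x))

variable {EM : Type*} [NormedAddCommGroup EM] [NormedSpace ℝ EM] [FiniteDimensional ℝ EM]
  {HM : Type*} [TopologicalSpace HM] {IM : ModelWithCorners ℝ EM HM}
  {M : Type*} [TopologicalSpace M] [ChartedSpace HM M] [IsManifold IM ∞ M]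
  [RiemannianBundle (fun x : M => TangentSpace IM x)]

theorem leviCivita_apply (V : ∀ x : M, TangentSpace IM x) (x : M) (u : TangentSpace IM x) :
    leviCivita IM V x u =
      ofCoord IM x x (mvfderiv IM (fun y => toCoord IM x y (V y)) x u) +
        christoffel IM x (V x) u := by
  simp [leviCivita]

theorem leviCivita_eq_connAlong_id (V : ∀ x : M, TangentSpace IM x) (x : M) :
    leviCivita IM V x = connAlong (ContMDiffMap.id : C^∞⟮IM, M; IM, M⟯) V x := by
  ext u
  refine (leviCivita_apply V x u).trans
    ((connAlong_apply (ContMDiffMap.id : C^∞⟮IM, M; IM, M⟯) V x u).trans ?_).symm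
  rw [diff_id_apply]
  rfl

variable [IsContMDiffRiemannianBundle IM ∞ EM (fun x : M => TangentSpace IM x)]

theorem leviCivita_ofCoord_symm {c x : M} (hx : x ∈ (chartAt HM c).source) (u v : EM) :
    leviCivita IM (fun y => ofCoord IM c y v) x (ofCoord IM c x u) =
      leviCivita IM (fun y => ofCoord IM c y u) x (ofCoord IM c x v) := by
  have h := connAlong_mfderiv_ofCoord_symm (ContMDiffMap.id : C^∞⟮IM, M; IM, M⟯) c hx v u
  have h1 (v : EM) : (fun y => diff (ContMDiffMap.id : C^∞⟮IM, M; IM, M⟯) y (ofCoord IM c y v)) =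
      fun y => ofCoord IM c y v :=
    funext fun y => diff_id_apply y _
  rw [h1, h1] at h
  rw [leviCivita_eq_connAlong_id, leviCivita_eq_connAlong_id]
  exact h

theorem mvfderiv_metricCoord {c x : M} (hx : x ∈ (chartAt HM c).source) (u v w : EM) :
    mvfderiv IM (metricCoord IM c) x (ofCoord IM c x u) v w =
      ⟪leviCivita IM (fun y => ofCoord IM c y v) x (ofCoord IM c x u), ofCoord IM c x w⟫ +
        ⟪ofCoord IM c x v, leviCivita IM (fun y => ofCoord IM c y w) x (ofCoord IM c x u)⟫ := by
  have hd : MDifferentiableAt IM 𝓘(ℝ, EM →L[ℝ] EM →L[ℝ] ℝ) (metricCoord IM c) x :=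
    (contMDiffAt_metricCoord IM hx).mdifferentiableAt (by simp)
  rw [← mvfderiv_clm_apply_const hd, ← mvfderiv_clm_apply_const
    (g := fun y => metricCoord IM c y v) (hd.clm_apply mdifferentiableAt_const)]
  rw [leviCivita_eq_connAlong_id, leviCivita_eq_connAlong_id]
  exact mvfderiv_inner_eq_connAlong (φ := ContMDiffMap.id) (contMDiffAt_section_ofCoord hx v)
    (contMDiffAt_section_ofCoord hx w) _

/-- The Koszul formula for the coordinate fields of an arbitrary chart. The connection at `x` is
defined in the preferred chart at `x`; this formula expresses it in a chart that does not vary with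
`x`, and thereby shows that it depends smoothly on `x`. -/
theorem inner_leviCivita_ofCoord {c x : M} (hx : x ∈ (chartAt HM c).source) (u v w : EM) :
    ⟪leviCivita IM (fun y => ofCoord IM c y v) x (ofCoord IM c x u), ofCoord IM c x w⟫ =
      (1 / 2 : ℝ) * (mvfderiv IM (metricCoord IM c) x (ofCoord IM c x u) v w +
        mvfderiv IM (metricCoord IM c) x (ofCoord IM c x v) u w -
        mvfderiv IM (metricCoord IM c) x (ofCoord IM c x w) u v) := by
  rw [mvfderiv_metricCoord hx, mvfderiv_metricCoord hx, mvfderiv_metricCoord hx,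
    leviCivita_ofCoord_symm hx v u, leviCivita_ofCoord_symm hx w u, leviCivita_ofCoord_symm hx w v,
    real_inner_comm _ (ofCoord IM c x u), real_inner_comm _ (ofCoord IM c x v)]
  ring

end LeviCivitaChart

section Along

variable {EL : Type*} [NormedAddCommGroup EL] [NormedSpace ℝ EL]
  {HL : Type*} [TopologicalSpace HL] {IL : ModelWithCorners ℝ EL HL}
  {L : Type*} [TopologicalSpace L] [ChartedSpace HL L]
  {EM : Type*} [NormedAddCommGroup EM] [NormedSpace ℝ EM] [FiniteDimensional ℝ EM]
  {HM : Type*} [TopologicalSpace HM] {IM : ModelWithCorners ℝ EM HM}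
  {M : Type*} [TopologicalSpace M] [ChartedSpace HM M] [IsManifold IM ∞ M]
  [RiemannianBundle (fun x : M => TangentSpace IM x)]
  (φ : C^∞⟮IL, L; IM, M⟯)

/-- The connection along `φ`, defined through the chart at `φ p`, computed in any other chart
around `φ p`. -/
theorem connAlong_eq_of_chart {V : ∀ p : L, TangentSpace IM (φ p)} {p : L} {c : M}
    (hc : φ p ∈ (chartAt HM c).source)
    (hV : ContMDiffAt IL IM.tangent ∞ (fun p => (⟨φ p, V p⟩ : TangentBundle IM M)) p)
    (X : TangentSpace IL p) :
    connAlong φ V p X =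
      ofCoord IM c (φ p) (mvfderiv IL (fun p' => toCoord IM c (φ p') (V p')) p X) +
        leviCivita IM (fun y => ofCoord IM c y (toCoord IM c (φ p) (V p))) (φ p)
          (diff φ p X) := by
  have hφ : MDifferentiableAt IL IM φ p := φ.contMDiff.mdifferentiableAt (by simp)
  have hself := mem_chart_source HM (φ p)
  -- the change of coordinates from the chart at `c` to the chart at `φ p`
  let C : M → EM →L[ℝ] EM := fun y => toCoord IM (φ p) y ∘L ofCoord IM c y
  have hCs : ContMDiffAt IM 𝓘(ℝ, EM →L[ℝ] EM) ∞ C (φ p) :=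
    contMDiffWithinAt_clm_of_apply fun v =>
      ((contMDiffWithinAt_section_iff_toCoord (b := id) (S := Set.univ) hself).1
        (contMDiffAt_section_ofCoord hc v)).2
  have hC : MDifferentiableAt IM 𝓘(ℝ, EM →L[ℝ] EM) C (φ p) := hCs.mdifferentiableAt (by simp)
  have hCφ : MDifferentiableAt IL 𝓘(ℝ, EM →L[ℝ] EM) (fun p' => C (φ p')) p := hC.comp p hφ
  have hev : (fun p' => toCoord IM (φ p) (φ p') (V p')) =ᶠ[𝓝 p]
      fun p' => C (φ p') (toCoord IM c (φ p') (V p')) := by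
    filter_upwards [φ.contMDiff.continuous.continuousAt ((chartAt HM c).open_source.mem_nhds hc)]
      with p' hp'
    simp [C, ofCoord_toCoord hp']
  rw [connAlong_apply, hev.mvfderiv_eq, mvfderiv_clm_apply hCφ (hV.mdifferentiableAt_toCoord hc),
    mvfderiv_comp_apply' p hC hφ, leviCivita_apply]
  have h2 : mvfderiv IM (fun y => toCoord IM (φ p) y (ofCoord IM c y
      (toCoord IM c (φ p) (V p)))) (φ p) (diff φ p X) =
      mvfderiv IM C (φ p) (diff φ p X) (toCoord IM c (φ p) (V p)) :=
    mvfderiv_clm_apply_const hC _ _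
  have h3 (a : EM) : ofCoord IM (φ p) (φ p) (C (φ p) a) = ofCoord IM c (φ p) a :=
    ofCoord_toCoord hself _
  rw [h2, map_add, h3, ofCoord_toCoord hc]
  change _ + _ + _ = _ + (ofCoord IM (φ p) (φ p)
    (mvfderiv IM C (φ p) (mfderiv IL IM φ p X) (toCoord IM c (φ p) (V p))) + _)
  abel

end Along

section Gram

variable {EL : Type*} [NormedAddCommGroup EL] [NormedSpace ℝ EL] [FiniteDimensional ℝ EL]
  {HL : Type*} [TopologicalSpace HL] {IL : ModelWithCorners ℝ EL HL}
  {L : Type*} [TopologicalSpace L] [ChartedSpace HL L] [IsManifold IL ∞ L]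
  [RiemannianBundle (fun p : L => TangentSpace IL p)]
  {EN : Type*} [NormedAddCommGroup EN] [NormedSpace ℝ EN]
  {HN : Type*} [TopologicalSpace HN] {IN : ModelWithCorners ℝ EN HN}
  {N : Type*} [TopologicalSpace N] [ChartedSpace HN N]

theorem isInvertible_metricCoord {c x : L} (hx : x ∈ (chartAt HL c).source) :
    (metricCoord IL c x).IsInvertible := by
  have hinj : Function.Injective (metricCoord IL c x) := by
    rw [injective_iff_map_eq_zero]
    intro v hv
    have h1 : (⟪(ofCoord IL c x v : TangentSpace IL x), ofCoord IL c x v⟫ : ℝ) = 0 :=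
      congrArg (fun A : EL →L[ℝ] ℝ => A v) hv
    rw [inner_self_eq_zero] at h1
    rw [← toCoord_ofCoord (IM := IL) hx v, h1, map_zero]
  have hdim : Module.finrank ℝ EL = Module.finrank ℝ (EL →L[ℝ] ℝ) := by
    rw [← (LinearMap.toContinuousLinearMap (𝕜 := ℝ) (E := EL) (F' := ℝ)).finrank_eq]
    exact (Subspace.dual_finrank_eq (K := ℝ) (V := EL)).symm
  exact ⟨(LinearEquiv.ofInjectiveOfFinrankEq (metricCoord IL c x).toLinearMap hinj
    hdim).toContinuousLinearEquiv, by ext; rfl⟩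

variable [IsContMDiffRiemannianBundle IL ∞ EL (fun p : L => TangentSpace IL p)]

/-- A section is smooth if its inner products with the coordinate fields are: the components are
recovered by the inverse of the metric. -/
theorem contMDiffWithinAt_section_of_inner_ofCoord {b : N → L} {U : ∀ n, TangentSpace IL (b n)}
    {S : Set N} {x : N} {c : L} (hx : b x ∈ (chartAt HL c).source)
    (hb : ContMDiffWithinAt IN IL ∞ b S x)
    (hU : ∀ v : EL, ContMDiffWithinAt IN 𝓘(ℝ, ℝ) ∞
      (fun n => (⟪U n, ofCoord IL c (b n) v⟫ : ℝ)) S x) :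
    ContMDiffWithinAt IN IL.tangent ∞ (fun n => (⟨b n, U n⟩ : TangentBundle IL L)) S x := by
  refine (contMDiffWithinAt_section_iff_toCoord hx).2 ⟨hb, ?_⟩
  let ℓ : N → EL →L[ℝ] ℝ := fun n => metricCoord IL c (b n) (toCoord IL c (b n) (U n))
  have hev : ∀ᶠ n in 𝓝[S] x, b n ∈ (chartAt HL c).source :=
    eventually_mem_chartAt_source hb.continuousWithinAt hx
  have hℓ : ContMDiffWithinAt IN 𝓘(ℝ, EL →L[ℝ] ℝ) ∞ ℓ S x := by
    refine contMDiffWithinAt_clm_of_apply fun v => (hU v).congr_of_eventuallyEq ?_ ?_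
    · filter_upwards [hev] with n hn
      simp [ℓ, metricCoord, ofCoord_toCoord hn]
    · simp [ℓ, metricCoord, ofCoord_toCoord hx]
  have hG : ContMDiffWithinAt IN 𝓘(ℝ, EL →L[ℝ] EL →L[ℝ] ℝ) ∞
      (fun n => metricCoord IL c (b n)) S x :=
    (contMDiffAt_metricCoord IL hx).comp_contMDiffWithinAt x hb
  have hGi : ContMDiffWithinAt IN 𝓘(ℝ, (EL →L[ℝ] ℝ) →L[ℝ] EL) ∞
      (fun n => (metricCoord IL c (b n)).inverse) S x := by
    obtain ⟨e, he⟩ := isInvertible_metricCoord (IL := IL) hx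
    have h := contDiffAt_map_inverse (n := ∞) e
    rw [he] at h
    exact h.contMDiffAt.comp_contMDiffWithinAt x hG
  have hinv {y : L} (hy : y ∈ (chartAt HL c).source) (v : EL) :
      (metricCoord IL c y).inverse (metricCoord IL c y v) = v := by
    obtain ⟨e, he⟩ := isInvertible_metricCoord (IL := IL) hy
    rw [← he, ContinuousLinearMap.inverse_equiv]
    exact e.symm_apply_apply v
  refine (hGi.clm_apply hℓ).congr_of_eventuallyEq ?_ (hinv hx _).symm
  filter_upwards [hev] with n hn
  exact (hinv hn _).symm

end Gram

/-! ### Tangential and normal components, shape operators -/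

section TangentialNormal

variable {EL : Type*} [NormedAddCommGroup EL] [NormedSpace ℝ EL] [FiniteDimensional ℝ EL]
  {HL : Type*} [TopologicalSpace HL] {IL : ModelWithCorners ℝ EL HL}
  {L : Type*} [TopologicalSpace L] [ChartedSpace HL L]
  [RiemannianBundle (fun p : L => TangentSpace IL p)]
  {EM : Type*} [NormedAddCommGroup EM] [NormedSpace ℝ EM] [FiniteDimensional ℝ EM]
  {HM : Type*} [TopologicalSpace HM] {IM : ModelWithCorners ℝ EM HM}
  {M : Type*} [TopologicalSpace M] [ChartedSpace HM M]
  [RiemannianBundle (fun x : M => TangentSpace IM x)]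
  {φ : C^∞⟮IL, L; IM, M⟯}

theorem inner_tang (p : L) (w : TangentSpace IM (φ p)) (X : TangentSpace IL p) :
    ⟪tang φ p w, X⟫ = ⟪w, diff φ p X⟫ :=
  LinearMap.adjoint_inner_left _ _ _

theorem tang_diff (hφ : IsIsometricImmersion φ) (p : L) (X : TangentSpace IL p) :
    tang φ p (diff φ p X) = X :=
  ext_inner_right ℝ fun Z => by rw [inner_tang, hφ]

theorem inner_nor_diff (hφ : IsIsometricImmersion φ) (p : L) (w : TangentSpace IM (φ p))
    (X : TangentSpace IL p) : ⟪nor φ p w, diff φ p X⟫ = 0 := by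
  change ⟪w - diff φ p (tang φ p w), diff φ p X⟫ = 0
  rw [inner_sub_left, hφ, inner_tang, sub_self]

theorem nor_eq_self {p : L} {w : TangentSpace IM (φ p)}
    (hw : ∀ X : TangentSpace IL p, ⟪w, diff φ p X⟫ = 0) : nor φ p w = w := by
  have h : tang φ p w = 0 := ext_inner_right ℝ fun Z => by rw [inner_tang, hw, inner_zero_left]
  change w - diff φ p (tang φ p w) = w
  rw [h, map_zero, sub_zero]

theorem normalExt_self [IsManifold IM ∞ M] (p : L) (w : TangentSpace IM (φ p)) :
    normalExt φ p w p = nor φ p w :=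
  congrArg (nor φ p) (coordField_self (φ p) w)

end TangentialNormal

section Submanifold

variable {EL : Type*} [NormedAddCommGroup EL] [NormedSpace ℝ EL]
  {HL : Type*} [TopologicalSpace HL] {IL : ModelWithCorners ℝ EL HL}
  {L : Type*} [TopologicalSpace L] [ChartedSpace HL L] [IsManifold IL ∞ L]
  {EM : Type*} [NormedAddCommGroup EM] [NormedSpace ℝ EM]
  {HM : Type*} [TopologicalSpace HM] {IM : ModelWithCorners ℝ EM HM}
  {M : Type*} [TopologicalSpace M] [ChartedSpace HM M] [IsManifold IM ∞ M]
  {EN : Type*} [NormedAddCommGroup EN] [NormedSpace ℝ EN]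
  {HN : Type*} [TopologicalSpace HN] {IN : ModelWithCorners ℝ EN HN}
  {N : Type*} [TopologicalSpace N] [ChartedSpace HN N]
  {φ : C^∞⟮IL, L; IM, M⟯}

theorem ContMDiffWithinAt.section_diff {b : N → L} {Y : ∀ n, TangentSpace IL (b n)} {S : Set N}
    {x : N}
    (hY : ContMDiffWithinAt IN IL.tangent ∞ (fun n => (⟨b n, Y n⟩ : TangentBundle IL L)) S x) :
    ContMDiffWithinAt IN IM.tangent ∞
      (fun n => (⟨φ (b n), diff φ (b n) (Y n)⟩ : TangentBundle IM M)) S x :=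
  ContMDiffWithinAt.section_mfderiv φ.contMDiff hY

variable [FiniteDimensional ℝ EM] [RiemannianBundle (fun x : M => TangentSpace IM x)]
  [IsContMDiffRiemannianBundle IM ∞ EM (fun x : M => TangentSpace IM x)]

/-- For a normal field `V`, differentiating `⟪V, dφ(∂_v)⟫ = 0` moves the derivative to the other
factor. -/
theorem inner_connAlong_diff_of_normal {V : ∀ p : L, TangentSpace IM (φ p)} {p p₀ : L}
    (hp : p ∈ (chartAt HL p₀).source)
    (hV : ContMDiffAt IL IM.tangent ∞ (fun p' => (⟨φ p', V p'⟩ : TangentBundle IM M)) p)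
    (hn : ∀ᶠ p' in 𝓝 p, ∀ X : TangentSpace IL p', ⟪V p', diff φ p' X⟫ = 0)
    (X : TangentSpace IL p) (v : EL) :
    ⟪connAlong φ V p X, diff φ p (ofCoord IL p₀ p v)⟫ =
      -⟪V p, connAlong φ (fun p' => diff φ p' (ofCoord IL p₀ p' v)) p X⟫ := by
  have hY : ContMDiffAt IL IM.tangent ∞
      (fun p' => (⟨φ p', diff φ p' (ofCoord IL p₀ p' v)⟩ : TangentBundle IM M)) p :=
    ContMDiffWithinAt.section_diff (b := id) (contMDiffAt_section_ofCoord hp v)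
  have h := mvfderiv_inner_eq_connAlong hV hY X
  rw [Filter.EventuallyEq.mvfderiv_eq (g := fun _ => (0 : ℝ)) (hn.mono fun p' hp' => hp' _),
    mvfderiv_const, zero_apply] at h
  linarith

set_option synthInstance.maxHeartbeats 200000 in
/-- The components `⟪W, ∇_{∂_w} dφ(∂_v)⟫` of the second fundamental form depend smoothly on the
point and on `W`. -/
theorem contMDiffWithinAt_inner_connAlong_diff
    {b : N → L} {W : ∀ n, TangentSpace IM (φ (b n))} {S : Set N} {x : N}
    (hb : ContMDiffWithinAt IN IL ∞ b S x)
    (hW : ContMDiffWithinAt IN IM.tangent ∞ (fun n => (⟨φ (b n), W n⟩ : TangentBundle IM M)) S x)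
    (v w : EL) :
    ContMDiffWithinAt IN 𝓘(ℝ, ℝ) ∞ (fun n => (⟪W n, connAlong φ
      (fun p => diff φ p (ofCoord IL (b x) p v)) (b n) (ofCoord IL (b x) (b n) w)⟫ : ℝ)) S x := by
  set c := φ (b x) with hc
  have hxc : b x ∈ (chartAt HL (b x)).source := mem_chart_source _ _
  have hcc : φ (b x) ∈ (chartAt HM c).source := mem_chart_source _ _
  have hφb : ContMDiffWithinAt IN IM ∞ (fun n => φ (b n)) S x :=
    φ.contMDiff.contMDiffAt.comp_contMDiffWithinAt x hb
  -- the coordinates of `dφ(∂_v)`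
  let F : EL → L → EM := fun v p => toCoord IM c (φ p) (diff φ p (ofCoord IL (b x) p v))
  have hsec (v : EL) {p : L} (hp : p ∈ (chartAt HL (b x)).source) :
      ContMDiffAt IL IM.tangent ∞
        (fun p => (⟨φ p, diff φ p (ofCoord IL (b x) p v)⟩ : TangentBundle IM M)) p :=
    ContMDiffWithinAt.section_diff (b := id) (contMDiffAt_section_ofCoord hp v)
  have hF (v : EL) : ContMDiffAt IL 𝓘(ℝ, EM) ∞ (F v) (b x) :=
    ((contMDiffWithinAt_section_iff_toCoord (S := Set.univ) hcc).1 (hsec v hxc)).2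
  have hFb (v : EL) : ContMDiffWithinAt IN 𝓘(ℝ, EM) ∞ (fun n => F v (b n)) S x :=
    (hF v).comp_contMDiffWithinAt x hb
  have hDF : ContMDiffWithinAt IN 𝓘(ℝ, EM) ∞
      (fun n => (mvfderiv IL (F v) (b n) ∘L ofCoord IL (b x) (b n)) w) S x :=
    ((hF v).mvfderiv_comp_ofCoord.comp_contMDiffWithinAt x hb).clm_apply contMDiffWithinAt_const
  have hW' := ((contMDiffWithinAt_section_iff_toCoord (b := fun n => φ (b n)) hcc).1 hW).2
  have hG : ContMDiffWithinAt IN 𝓘(ℝ, EM →L[ℝ] EM →L[ℝ] ℝ) ∞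
      (fun n => metricCoord IM c (φ (b n))) S x :=
    ContMDiffAt.comp_contMDiffWithinAt (g := metricCoord IM c) (f := fun n => φ (b n)) x
      (contMDiffAt_metricCoord IM hcc) hφb
  have hDG :=
    ContMDiffAt.comp_contMDiffWithinAt (f := fun n => φ (b n))
      (g := fun y => mvfderiv IM (metricCoord IM c) y ∘L ofCoord IM c y) x
      (contMDiffAt_metricCoord IM (mem_chart_source HM c)).mvfderiv_comp_ofCoord hφb
  let R : N → ℝ := fun n =>
    metricCoord IM c (φ (b n)) (toCoord IM c (φ (b n)) (W n))
        ((mvfderiv IL (F v) (b n) ∘L ofCoord IL (b x) (b n)) w) +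
      (1 / 2 : ℝ) *
        ((mvfderiv IM (metricCoord IM c) (φ (b n)) ∘L ofCoord IM c (φ (b n)))
            (F w (b n)) (F v (b n)) (toCoord IM c (φ (b n)) (W n)) +
          (mvfderiv IM (metricCoord IM c) (φ (b n)) ∘L ofCoord IM c (φ (b n)))
            (F v (b n)) (F w (b n)) (toCoord IM c (φ (b n)) (W n)) -
          (mvfderiv IM (metricCoord IM c) (φ (b n)) ∘L ofCoord IM c (φ (b n)))
            (toCoord IM c (φ (b n)) (W n)) (F w (b n)) (F v (b n)))
  have key : ∀ n, b n ∈ (chartAt HL (b x)).source → φ (b n) ∈ (chartAt HM c).source →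
      (⟪W n, connAlong φ
        (fun p => diff φ p (ofCoord IL (b x) p v)) (b n) (ofCoord IL (b x) (b n) w)⟫ : ℝ) =
      R n := by
    intro n hn hφn
    rw [connAlong_eq_of_chart φ hφn (hsec v hn), inner_add_right]
    congr 1
    · simp [metricCoord, ofCoord_toCoord hφn, F]
    · have := inner_leviCivita_ofCoord (IM := IM) hφn (F w (b n)) (F v (b n))
        (toCoord IM c (φ (b n)) (W n))
      refine (real_inner_comm _ _).trans (Eq.trans ?_ this)
      rw [ofCoord_toCoord hφn (W n), show ofCoord IM c (φ (b n)) (F w (b n)) =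
        diff φ (b n) (ofCoord IL (b x) (b n) w) from ofCoord_toCoord hφn _]
  have hR : ContMDiffWithinAt IN 𝓘(ℝ, ℝ) ∞ R S x :=
    ((hG.clm_apply hW').clm_apply hDF).add (contMDiffWithinAt_const.mul
      (((((hDG.clm_apply (hFb w)).clm_apply (hFb v)).clm_apply hW').add
        (((hDG.clm_apply (hFb v)).clm_apply (hFb w)).clm_apply hW')).sub
        (((hDG.clm_apply hW').clm_apply (hFb w)).clm_apply (hFb v))))
  refine hR.congr_of_eventuallyEq ?_ (key x hxc hcc)
  filter_upwards [eventually_mem_chartAt_source hb.continuousWithinAt hxc,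
    eventually_mem_chartAt_source hφb.continuousWithinAt hcc] with n hn hφn
  exact key n hn hφn

variable [FiniteDimensional ℝ EL] [RiemannianBundle (fun p : L => TangentSpace IL p)]

theorem ContMDiffWithinAt.section_tang
    [IsContMDiffRiemannianBundle IL ∞ EL (fun p : L => TangentSpace IL p)]
    {b : N → L} {W : ∀ n, TangentSpace IM (φ (b n))} {S : Set N} {x : N}
    (hb : ContMDiffWithinAt IN IL ∞ b S x)
    (hW : ContMDiffWithinAt IN IM.tangent ∞
      (fun n => (⟨φ (b n), W n⟩ : TangentBundle IM M)) S x) :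
    ContMDiffWithinAt IN IL.tangent ∞
      (fun n => (⟨b n, tang φ (b n) (W n)⟩ : TangentBundle IL L)) S x := by
  refine contMDiffWithinAt_section_of_inner_ofCoord (mem_chart_source HL (b x)) hb fun v => ?_
  simp only [inner_tang]
  exact ContMDiffWithinAt.inner_section (b := fun n => φ (b n)) hW
    (ContMDiffWithinAt.section_diff
      (ContMDiffWithinAt.section_ofCoord (mem_chart_source HL (b x)) hb contMDiffWithinAt_const))

theorem ContMDiffWithinAt.section_nor
    [IsContMDiffRiemannianBundle IL ∞ EL (fun p : L => TangentSpace IL p)]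
    {b : N → L} {W : ∀ n, TangentSpace IM (φ (b n))} {S : Set N} {x : N}
    (hb : ContMDiffWithinAt IN IL ∞ b S x)
    (hW : ContMDiffWithinAt IN IM.tangent ∞
      (fun n => (⟨φ (b n), W n⟩ : TangentBundle IM M)) S x) :
    ContMDiffWithinAt IN IM.tangent ∞
      (fun n => (⟨φ (b n), nor φ (b n) (W n)⟩ : TangentBundle IM M)) S x :=
  ContMDiffWithinAt.section_sub (b := fun n => φ (b n)) hW
    (ContMDiffWithinAt.section_diff (ContMDiffWithinAt.section_tang hb hW))

variable [IsContMDiffRiemannianBundle IL ∞ EL (fun p : L => TangentSpace IL p)]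

theorem contMDiffAt_normalExt (p : L) (w : TangentSpace IM (φ p)) :
    ContMDiffAt IL IM.tangent ∞
      (fun p' => (⟨φ p', normalExt φ p w p'⟩ : TangentBundle IM M)) p :=
  ContMDiffWithinAt.section_nor (b := id) contMDiffWithinAt_id
    (ContMDiffWithinAt.section_ofCoord (b := fun n => φ n) (mem_chart_source HM (φ p))
      φ.contMDiff.contMDiffAt contMDiffWithinAt_const)

/-- The shape operator is dual to the second fundamental form. -/
theorem inner_shape (hφ : IsIsometricImmersion φ) {p p₀ : L} (hp : p ∈ (chartAt HL p₀).source)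
    (w : TangentSpace IM (φ p)) (X : TangentSpace IL p) (v : EL) :
    ⟪shape φ p w X, ofCoord IL p₀ p v⟫ =
      ⟪nor φ p w, connAlong φ (fun p' => diff φ p' (ofCoord IL p₀ p' v)) p X⟫ := by
  change ⟪-tang φ p (connAlong φ (normalExt φ p w) p X), ofCoord IL p₀ p v⟫ = _
  rw [inner_neg_left, inner_tang, inner_connAlong_diff_of_normal hp (contMDiffAt_normalExt p w)
    (Filter.Eventually.of_forall fun p' X => inner_nor_diff hφ _ _ _), normalExt_self, neg_neg]

theorem shape_isSymmetric (hφ : IsIsometricImmersion φ) (p : L) (w : TangentSpace IM (φ p)) :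
    (shape φ p w).IsSymmetric := by
  intro X Y
  have hp := mem_chart_source HL p
  rw [← ofCoord_toCoord hp X, ← ofCoord_toCoord hp Y, inner_shape hφ hp,
    real_inner_comm (shape φ p w _), inner_shape hφ hp, connAlong_mfderiv_ofCoord_symm φ p hp]

/-- The Weingarten formula in a direction in which the normal field is parallel. -/
theorem connAlong_eq_neg_shape_of_connNor_eq_zero (hφ : IsIsometricImmersion φ)
    {V : ∀ p : L, TangentSpace IM (φ p)} {p : L}
    (hV : ContMDiffAt IL IM.tangent ∞ (fun p' => (⟨φ p', V p'⟩ : TangentBundle IM M)) p)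
    (hn : ∀ᶠ p' in 𝓝 p, ∀ X : TangentSpace IL p', ⟪V p', diff φ p' X⟫ = 0)
    {X : TangentSpace IL p} (hX : connNor φ V p X = 0) :
    connAlong φ V p X = -diff φ p (shape φ p (V p) X) := by
  have hp := mem_chart_source HL p
  have h1 : connAlong φ V p X = diff φ p (tang φ p (connAlong φ V p X)) := sub_eq_zero.1 hX
  have h2 : tang φ p (connAlong φ V p X) = -shape φ p (V p) X := by
    refine ext_inner_right ℝ fun Y => ?_
    rw [← ofCoord_toCoord hp Y, inner_tang, inner_connAlong_diff_of_normal hp hV hn,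
      inner_neg_left, inner_shape hφ hp, nor_eq_self hn.self_of_nhds]
  rw [h1, h2, map_neg]

theorem contMDiffWithinAt_shape_ofCoord (hφ : IsIsometricImmersion φ)
    {b : N → L} {W : ∀ n, TangentSpace IM (φ (b n))} {S : Set N} {x : N}
    (hb : ContMDiffWithinAt IN IL ∞ b S x)
    (hW : ContMDiffWithinAt IN IM.tangent ∞ (fun n => (⟨φ (b n), W n⟩ : TangentBundle IM M)) S x)
    (w : EL) :
    ContMDiffWithinAt IN IL.tangent ∞ (fun n => (⟨b n, shape φ (b n) (W n)
      (ofCoord IL (b x) (b n) w)⟩ : TangentBundle IL L)) S x := by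
  have hx := mem_chart_source HL (b x)
  refine contMDiffWithinAt_section_of_inner_ofCoord hx hb fun v => ?_
  refine (contMDiffWithinAt_inner_connAlong_diff hb (ContMDiffWithinAt.section_nor hb hW) v
    w).congr_of_eventuallyEq ?_ (inner_shape hφ hx _ _ _)
  filter_upwards [eventually_mem_chartAt_source hb.continuousWithinAt hx] with n hn
  exact inner_shape hφ hn _ _ _

end Submanifold

/-! ### Algebra of the generalized Newton transformation -/

section NewtonAlgebra

variable {V : Type*} [AddCommGroup V] [Module ℝ V] [FiniteDimensional ℝ V] {q : ℕ}

theorem newton_zero (A : Fin q → Module.End ℝ V) : newton A 0 = 1 := by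
  rw [newton]; simp

theorem newton_of_ne_zero (A : Fin q → Module.End ℝ V) {u : Fin q →₀ ℕ} (hu : u ≠ 0) :
    newton A u = symmFun A u • (1 : Module.End ℝ V) -
      ∑ α, if u α ≠ 0 then A α * newton A (flat α u) else 0 := by
  rw [newton, if_neg hu]
  simp only [dite_eq_ite]

/-- The matrix `1 + ∑ t_α A_α` over the polynomial ring whose determinant is the characteristic
polynomial. -/
def charMatrix {n : Type*} [Fintype n] [DecidableEq n] {R : Type*} [CommRing R]
    (m : Fin q → Matrix n n R) : Matrix n n (MvPolynomial (Fin q) R) :=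
  1 + ∑ α, (MvPolynomial.X α : MvPolynomial (Fin q) R) •
    (m α).map (MvPolynomial.C : R →+* MvPolynomial (Fin q) R)

theorem coeff_X_smul_map_C_mul {n : Type*} [Fintype n] (m : Matrix n n ℝ)
    (Q : Matrix n n (MvPolynomial (Fin q) ℝ)) (α : Fin q) (u : Fin q →₀ ℕ) :
    (((MvPolynomial.X α : MvPolynomial (Fin q) ℝ) •
      m.map (MvPolynomial.C : ℝ →+* MvPolynomial (Fin q) ℝ)) * Q).map (MvPolynomial.coeff u) =
      if u α ≠ 0 then m * Q.map (MvPolynomial.coeff (flat α u)) else 0 := by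
  ext i j
  rw [Matrix.smul_mul, Matrix.map_apply, Matrix.smul_apply, smul_eq_mul,
    MvPolynomial.coeff_X_mul']
  by_cases h : u α = 0
  · simp [h]
  · simp [h, Matrix.mul_apply, flat, MvPolynomial.coeff_sum]

theorem coeff_mul_X_smul_map_C {n : Type*} [Fintype n] (m : Matrix n n ℝ)
    (Q : Matrix n n (MvPolynomial (Fin q) ℝ)) (α : Fin q) (u : Fin q →₀ ℕ) :
    (Q * ((MvPolynomial.X α : MvPolynomial (Fin q) ℝ) •
      m.map (MvPolynomial.C : ℝ →+* MvPolynomial (Fin q) ℝ))).map (MvPolynomial.coeff u) =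
      if u α ≠ 0 then Q.map (MvPolynomial.coeff (flat α u)) * m else 0 := by
  ext i j
  rw [Matrix.mul_smul, Matrix.map_apply, Matrix.smul_apply, smul_eq_mul,
    MvPolynomial.coeff_X_mul']
  by_cases h : u α = 0
  · simp [h]
  · simp [h, Matrix.mul_apply, flat, MvPolynomial.coeff_sum,
      mul_comm _ (MvPolynomial.C (σ := Fin q) (m _ j)), mul_comm _ (m _ j)]

theorem map_coeff_smul_one {n : Type*} [DecidableEq n] (p : MvPolynomial (Fin q) ℝ)
    (u : Fin q →₀ ℕ) :
    (p • (1 : Matrix n n (MvPolynomial (Fin q) ℝ))).map (MvPolynomial.coeff u) =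
      MvPolynomial.coeff u p • (1 : Matrix n n ℝ) := by
  ext i j
  by_cases h : i = j <;> simp [h]

theorem coeff_adjugate_left {n : Type*} [Fintype n] [DecidableEq n] (m : Fin q → Matrix n n ℝ)
    (u : Fin q →₀ ℕ) :
    (charMatrix m).adjugate.map (MvPolynomial.coeff u) +
      ∑ α, (if u α ≠ 0 then m α * (charMatrix m).adjugate.map (MvPolynomial.coeff (flat α u))
        else 0) = MvPolynomial.coeff u (charMatrix m).det • (1 : Matrix n n ℝ) := by
  rw [← map_coeff_smul_one, ← Matrix.mul_adjugate]
  conv_rhs => rw [charMatrix, add_mul, one_mul, Finset.sum_mul]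
  simp only [← coeff_X_smul_map_C_mul]
  ext i j
  simp [Matrix.sum_apply, MvPolynomial.coeff_sum, charMatrix]

theorem coeff_adjugate_right {n : Type*} [Fintype n] [DecidableEq n] (m : Fin q → Matrix n n ℝ)
    (u : Fin q →₀ ℕ) :
    (charMatrix m).adjugate.map (MvPolynomial.coeff u) +
      ∑ α, (if u α ≠ 0 then (charMatrix m).adjugate.map (MvPolynomial.coeff (flat α u)) * m α
        else 0) = MvPolynomial.coeff u (charMatrix m).det • (1 : Matrix n n ℝ) := by
  rw [← map_coeff_smul_one, ← Matrix.adjugate_mul]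
  conv_rhs => rw [charMatrix, mul_add, mul_one, Finset.mul_sum]
  simp only [← coeff_mul_X_smul_map_C]
  ext i j
  simp [Matrix.sum_apply, MvPolynomial.coeff_sum, charMatrix]

theorem coeff_zero_det_charMatrix {n : Type*} [Fintype n] [DecidableEq n]
    (m : Fin q → Matrix n n ℝ) : MvPolynomial.coeff 0 (charMatrix m).det = 1 := by
  have h : (MvPolynomial.constantCoeff : MvPolynomial (Fin q) ℝ →+* ℝ) (charMatrix m).det = 1 := by
    rw [RingHom.map_det]
    convert Matrix.det_one (n := n) (R := ℝ)
    ext i j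
    by_cases h : i = j <;> simp [charMatrix, Matrix.sum_apply, h, Matrix.one_apply]
  rwa [MvPolynomial.constantCoeff_eq] at h

/-- The generalized Newton transformations are the coefficients of the adjugate of
`1 + ∑ t_α A_α`, as the recursion that defines them is `M * adjugate M = det M • 1`, read
coefficientwise. -/
theorem toMatrix_newton (A : Fin q → Module.End ℝ V) (u : Fin q →₀ ℕ) :
    LinearMap.toMatrix (Module.finBasis ℝ V) (Module.finBasis ℝ V) (newton A u) =
      (charMatrix fun α => LinearMap.toMatrix (Module.finBasis ℝ V) (Module.finBasis ℝ V)
        (A α)).adjugate.map (MvPolynomial.coeff u) := by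
  induction hd : u.degree using Nat.strong_induction_on generalizing u with
  | _ d ih =>
    have h := coeff_adjugate_left (fun α => LinearMap.toMatrix (Module.finBasis ℝ V)
      (Module.finBasis ℝ V) (A α)) u
    by_cases hu : u = 0
    · subst hu
      rw [coeff_zero_det_charMatrix] at h
      simp at h
      rw [newton_zero, h, LinearMap.toMatrix_one]
    · rw [newton_of_ne_zero A hu, eq_sub_of_add_eq h, map_sub, map_smul, LinearMap.toMatrix_one,
        map_sum]
      congr 1
      refine Finset.sum_congr rfl fun α _ => ?_
      by_cases hα : u α = 0
      · simp [hα]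
      · rw [if_pos hα, if_pos hα, LinearMap.toMatrix_mul,
          ih _ (hd ▸ degree_flat_lt hα) _ rfl]

/-- The mirrored recursion, from `adjugate M * M = det M • 1`. -/
theorem newton_eq_sub_sum_mul (A : Fin q → Module.End ℝ V) (u : Fin q →₀ ℕ) :
    newton A u = symmFun A u • (1 : Module.End ℝ V) -
      ∑ α, if u α ≠ 0 then newton A (flat α u) * A α else 0 := by
  apply (LinearMap.toMatrix (Module.finBasis ℝ V) (Module.finBasis ℝ V)).injective
  rw [map_sub, map_smul, LinearMap.toMatrix_one, map_sum, toMatrix_newton,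
    eq_sub_of_add_eq (coeff_adjugate_right _ u)]
  congr 1
  refine Finset.sum_congr rfl fun α _ => ?_
  by_cases hα : u α = 0
  · simp [hα]
  · rw [if_pos hα, if_pos hα, LinearMap.toMatrix_mul, toMatrix_newton]

/-- `newton A u` is selfadjoint, as taking adjoints turns the recursion into its mirror image. -/
theorem newton_isSymmetric {V : Type*} [NormedAddCommGroup V] [InnerProductSpace ℝ V]
    [FiniteDimensional ℝ V] (A : Fin q → Module.End ℝ V) (hA : ∀ α, (A α).IsSymmetric)
    (u : Fin q →₀ ℕ) : (newton A u).IsSymmetric := by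
  induction hd : u.degree using Nat.strong_induction_on generalizing u with
  | _ d ih =>
    intro x y
    by_cases hu : u = 0
    · subst hu
      simp [newton_zero]
    · conv_lhs => rw [newton_of_ne_zero A hu]
      conv_rhs => rw [newton_eq_sub_sum_mul A u]
      simp only [LinearMap.sub_apply, LinearMap.sum_apply, LinearMap.smul_apply, inner_sub_left,
        inner_sub_right, sum_inner, inner_sum]
      congr 1
      · simp [inner_smul_left, inner_smul_right]
      · refine Finset.sum_congr rfl fun α _ => ?_
        by_cases hα : u α = 0
        · simp [hα]
        · rw [if_pos hα, if_pos hα, Module.End.mul_apply, Module.End.mul_apply, hA α,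
            ih _ (hd ▸ degree_flat_lt hα) _ rfl]

theorem det_charMatrix_conj {n n' : Type*} [Fintype n] [DecidableEq n] [Fintype n']
    [DecidableEq n'] (m : Fin q → Matrix n n ℝ) (Pm : Matrix n' n ℝ) (Pi : Matrix n n' ℝ)
    (h1 : Pm * Pi = 1) (h2 : Pi * Pm = 1) :
    (charMatrix fun α => Pm * m α * Pi).det = (charMatrix m).det := by
  have h1' : Pm.map (MvPolynomial.C : ℝ →+* MvPolynomial (Fin q) ℝ) *
      Pi.map (MvPolynomial.C : ℝ →+* MvPolynomial (Fin q) ℝ) = 1 := by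
    rw [← Matrix.map_mul, h1, Matrix.map_one _ (map_zero _) (map_one _)]
  have h2' : Pi.map (MvPolynomial.C : ℝ →+* MvPolynomial (Fin q) ℝ) *
      Pm.map (MvPolynomial.C : ℝ →+* MvPolynomial (Fin q) ℝ) = 1 := by
    rw [← Matrix.map_mul, h2, Matrix.map_one _ (map_zero _) (map_one _)]
  have hC : (charMatrix fun α => Pm * m α * Pi) =
      Pm.map (MvPolynomial.C : ℝ →+* MvPolynomial (Fin q) ℝ) * charMatrix m *
        Pi.map (MvPolynomial.C : ℝ →+* MvPolynomial (Fin q) ℝ) := by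
    simp only [charMatrix, Matrix.mul_add, Matrix.add_mul, Matrix.mul_one, Matrix.mul_sum,
      Matrix.sum_mul, Matrix.mul_smul, Matrix.smul_mul, Matrix.map_mul, h1']
  rw [hC, Matrix.det_conj_of_mul_eq_one h1' h2']

/-- `symmFun` is invariant under linear isomorphisms, so that it may be computed in a chart. -/
theorem symmFun_conj {W : Type*} [AddCommGroup W] [Module ℝ W] [FiniteDimensional ℝ W]
    (e : V ≃ₗ[ℝ] W) (A : Fin q → Module.End ℝ V) (u : Fin q →₀ ℕ) :
    symmFun (fun α => e.conj (A α)) u = symmFun A u := by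
  set b := Module.finBasis ℝ V
  set b' := Module.finBasis ℝ W
  have h := det_charMatrix_conj (fun α => LinearMap.toMatrix b b (A α))
    (LinearMap.toMatrix b b' e.toLinearMap) (LinearMap.toMatrix b' b e.symm.toLinearMap)
    (by rw [← LinearMap.toMatrix_comp]; simp) (by rw [← LinearMap.toMatrix_comp]; simp)
  have h2 (α : Fin q) : LinearMap.toMatrix b' b' (e.conj (A α)) =
      LinearMap.toMatrix b b' e.toLinearMap * LinearMap.toMatrix b b (A α) *
        LinearMap.toMatrix b' b e.symm.toLinearMap := by
    rw [← LinearMap.toMatrix_comp, ← LinearMap.toMatrix_comp]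
    rfl
  simp only [← h2] at h
  exact congrArg (MvPolynomial.coeff u) h

end NewtonAlgebra

section NewtonSmooth

variable {EN : Type*} [NormedAddCommGroup EN] [NormedSpace ℝ EN]
  {HN : Type*} [TopologicalSpace HN] {IN : ModelWithCorners ℝ EN HN}
  {N : Type*} [TopologicalSpace N] [ChartedSpace HN N] {q : ℕ}

variable (IN) in
/-- The ring of real functions that are smooth at `x` within `S`. Polynomial expressions in smooth
functions, such as the coefficients of a determinant, can be formed over this ring. -/
def smoothWithinAtSubring (S : Set N) (x : N) : Subring (N → ℝ) where
  carrier := {f | ContMDiffWithinAt IN 𝓘(ℝ, ℝ) ∞ f S x}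
  mul_mem' hf hg := hf.mul hg
  one_mem' := contMDiffWithinAt_const
  add_mem' hf hg := hf.add hg
  zero_mem' := contMDiffWithinAt_const
  neg_mem' hf := hf.neg

theorem ContMDiffWithinAt.coeff_det_charMatrix {n : Type*} [Fintype n] [DecidableEq n]
    {S : Set N} {x : N} {m : N → Fin q → Matrix n n ℝ}
    (hm : ∀ α i j, ContMDiffWithinAt IN 𝓘(ℝ, ℝ) ∞ (fun y => m y α i j) S x) (u : Fin q →₀ ℕ) :
    ContMDiffWithinAt IN 𝓘(ℝ, ℝ) ∞
      (fun y => MvPolynomial.coeff u (charMatrix (m y)).det) S x := by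
  let R := smoothWithinAtSubring IN S x
  let mR : Fin q → Matrix n n R := fun α i j => ⟨fun y => m y α i j, hm α i j⟩
  have h : (fun y => MvPolynomial.coeff u (charMatrix (m y)).det) =
      ((MvPolynomial.coeff u (charMatrix mR).det : R) : N → ℝ) := by
    funext y
    -- evaluation at `y` commutes with the formation of determinants and coefficients
    let ev : R →+* ℝ := (Pi.evalRingHom (fun _ : N => ℝ) y).comp R.subtype
    change _ = ev (MvPolynomial.coeff u (charMatrix mR).det)
    rw [← MvPolynomial.coeff_map, RingHom.map_det]
    congr 2
    ext1 i j
    by_cases hij : i = j <;>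
      simp [charMatrix, Matrix.sum_apply, hij] <;> rfl
  rw [h]
  exact (MvPolynomial.coeff u (charMatrix mR).det).2

end NewtonSmooth

/-! ### Smoothness of the Newton transformation of the shape operators -/

section EndSections

variable {EL : Type*} [NormedAddCommGroup EL] [NormedSpace ℝ EL] [FiniteDimensional ℝ EL]
  {HL : Type*} [TopologicalSpace HL] {IL : ModelWithCorners ℝ EL HL}
  {L : Type*} [TopologicalSpace L] [ChartedSpace HL L] [IsManifold IL ∞ L]
  {EN : Type*} [NormedAddCommGroup EN] [NormedSpace ℝ EN]
  {HN : Type*} [TopologicalSpace HN] {IN : ModelWithCorners ℝ EN HN}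
  {N : Type*} [TopologicalSpace N] [ChartedSpace HN N]

variable (IL) in
/-- The endomorphism `T` of `T_x L`, written in the preferred chart at `c`. -/
def endCoord (c x : L) (T : Module.End ℝ (TangentSpace IL x)) : EL →L[ℝ] EL :=
  LinearMap.toContinuousLinearMap
    ((toCoord IL c x).toLinearMap ∘ₗ T ∘ₗ (ofCoord IL c x).toLinearMap)

theorem endCoord_apply (c x : L) (T : Module.End ℝ (TangentSpace IL x)) (v : EL) :
    endCoord IL c x T v = toCoord IL c x (T (ofCoord IL c x v)) := rfl

theorem endCoord_toCoord {c x : L} (hx : x ∈ (chartAt HL c).source)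
    (T : Module.End ℝ (TangentSpace IL x)) (v : TangentSpace IL x) :
    endCoord IL c x T (toCoord IL c x v) = toCoord IL c x (T v) := by
  rw [endCoord_apply, ofCoord_toCoord hx]

theorem contMDiffWithinAt_endCoord {b : N → L} {T : ∀ n, Module.End ℝ (TangentSpace IL (b n))}
    {S : Set N} {x : N} {c : L} (hx : b x ∈ (chartAt HL c).source)
    (hT : ∀ v : EL, ContMDiffWithinAt IN IL.tangent ∞
      (fun n => (⟨b n, T n (ofCoord IL c (b n) v)⟩ : TangentBundle IL L)) S x) :
    ContMDiffWithinAt IN 𝓘(ℝ, EL →L[ℝ] EL) ∞ (fun n => endCoord IL c (b n) (T n)) S x :=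
  contMDiffWithinAt_clm_of_apply fun v =>
    ((contMDiffWithinAt_section_iff_toCoord hx).1 (hT v)).2

theorem ContMDiffWithinAt.section_end_apply {b : N → L}
    {T : ∀ n, Module.End ℝ (TangentSpace IL (b n))} {Y : ∀ n, TangentSpace IL (b n)}
    {S : Set N} {x : N} {c : L} (hx : b x ∈ (chartAt HL c).source)
    (hT : ∀ v : EL, ContMDiffWithinAt IN IL.tangent ∞
      (fun n => (⟨b n, T n (ofCoord IL c (b n) v)⟩ : TangentBundle IL L)) S x)
    (hY : ContMDiffWithinAt IN IL.tangent ∞ (fun n => (⟨b n, Y n⟩ : TangentBundle IL L)) S x) :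
    ContMDiffWithinAt IN IL.tangent ∞ (fun n => (⟨b n, T n (Y n)⟩ : TangentBundle IL L)) S x := by
  rw [contMDiffWithinAt_section_iff_toCoord hx] at hY ⊢
  refine ⟨hY.1, ((contMDiffWithinAt_endCoord hx hT).clm_apply hY.2).congr_of_eventuallyEq ?_
    (endCoord_toCoord hx _ _).symm⟩
  filter_upwards [eventually_mem_chartAt_source hY.1.continuousWithinAt hx] with n hn
  exact (endCoord_toCoord hn _ _).symm

theorem contMDiffWithinAt_symmFun {q : ℕ} {b : N → L}
    {A : ∀ n, Fin q → Module.End ℝ (TangentSpace IL (b n))}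
    {S : Set N} {x : N} {c : L} (hx : b x ∈ (chartAt HL c).source)
    (hb : ContMDiffWithinAt IN IL ∞ b S x)
    (hA : ∀ α (v : EL), ContMDiffWithinAt IN IL.tangent ∞
      (fun n => (⟨b n, A n α (ofCoord IL c (b n) v)⟩ : TangentBundle IL L)) S x)
    (u : Fin q →₀ ℕ) :
    ContMDiffWithinAt IN 𝓘(ℝ, ℝ) ∞ (fun n => symmFun (A n) u) S x := by
  have hconj : ∀ n, b n ∈ (chartAt HL c).source → symmFun (A n) u =
      symmFun (fun α => (endCoord IL c (b n) (A n α) : EL →ₗ[ℝ] EL)) u := by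
    intro n hn
    let e : TangentSpace IL (b n) ≃ₗ[ℝ] EL := LinearEquiv.ofLinearMap
      (toCoord IL c (b n)).toLinearMap (ofCoord IL c (b n)).toLinearMap
      (LinearMap.ext fun v => toCoord_ofCoord hn v) (LinearMap.ext fun v => ofCoord_toCoord hn v)
    exact (symmFun_conj e (A n) u).symm
  have h : ContMDiffWithinAt IN 𝓘(ℝ, ℝ) ∞ (fun n =>
      symmFun (fun α => (endCoord IL c (b n) (A n α) : EL →ₗ[ℝ] EL)) u) S x := by
    refine ContMDiffWithinAt.coeff_det_charMatrix (fun α i j => ?_) u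
    simp only [LinearMap.toMatrix_apply]
    have h1 := (contMDiffWithinAt_endCoord hx (hA α)).clm_apply
      (contMDiffWithinAt_const (c := Module.finBasis ℝ EL j))
    exact (((Module.finBasis ℝ EL).coord i).toContinuousLinearMap.contMDiff
      (n := ∞)).contMDiffAt.comp_contMDiffWithinAt x h1
  refine h.congr_of_eventuallyEq ?_ (hconj x hx)
  filter_upwards [eventually_mem_chartAt_source hb.continuousWithinAt hx] with n hn
  exact hconj n hn

theorem ContMDiffWithinAt.section_newton {q : ℕ} {b : N → L}
    {A : ∀ n, Fin q → Module.End ℝ (TangentSpace IL (b n))}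
    {S : Set N} {x : N} {c : L} (hx : b x ∈ (chartAt HL c).source)
    (hb : ContMDiffWithinAt IN IL ∞ b S x)
    (hA : ∀ α (v : EL), ContMDiffWithinAt IN IL.tangent ∞
      (fun n => (⟨b n, A n α (ofCoord IL c (b n) v)⟩ : TangentBundle IL L)) S x)
    (u : Fin q →₀ ℕ) (v : EL) :
    ContMDiffWithinAt IN IL.tangent ∞
      (fun n => (⟨b n, newton (A n) u (ofCoord IL c (b n) v)⟩ : TangentBundle IL L)) S x := by
  induction hd : u.degree using Nat.strong_induction_on generalizing u v with
  | _ d ih =>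
    have hv : ContMDiffWithinAt IN IL.tangent ∞
        (fun n => (⟨b n, ofCoord IL c (b n) v⟩ : TangentBundle IL L)) S x :=
      ContMDiffWithinAt.section_ofCoord hx hb contMDiffWithinAt_const
    by_cases hu : u = 0
    · subst hu
      simpa only [newton_zero, Module.End.one_apply] using hv
    · simp only [newton_of_ne_zero _ hu, LinearMap.sub_apply, LinearMap.sum_apply,
        LinearMap.smul_apply, Module.End.one_apply]
      have hv' := ((contMDiffWithinAt_section_iff_toCoord hx).1 hv).2
      refine (contMDiffWithinAt_section_iff_toCoord hx).2 ⟨hb, ?_⟩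
      simp only [map_sub, map_sum, map_smul]
      refine ((contMDiffWithinAt_symmFun hx hb hA u).smul hv').sub
        (contMDiffWithinAt_finsetSum fun α _ => ?_)
      by_cases hα : u α = 0
      · simpa [hα] using contMDiffWithinAt_const
      · simp only [hα, ne_eq, not_false_eq_true, if_true, Module.End.mul_apply]
        exact ((contMDiffWithinAt_section_iff_toCoord hx).1
          (ContMDiffWithinAt.section_end_apply hx (fun v => hA α v)
            (ih _ (hd ▸ degree_flat_lt hα) _ v rfl))).2

end EndSections

section Tuples

variable {EL : Type*} [NormedAddCommGroup EL] [NormedSpace ℝ EL]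
  {HL : Type*} [TopologicalSpace HL] {IL : ModelWithCorners ℝ EL HL}
  {L : Type*} [TopologicalSpace L] [ChartedSpace HL L]
  {EM : Type*} [NormedAddCommGroup EM] [NormedSpace ℝ EM]
  {HM : Type*} [TopologicalSpace HM] {IM : ModelWithCorners ℝ EM HM}
  {M : Type*} [TopologicalSpace M] [ChartedSpace HM M] [IsManifold IM ∞ M]
  {φ : C^∞⟮IL, L; IM, M⟯} {q : ℕ}

variable (φ q) in
/-- The fibre coordinate of `y` in the trivialization of `Tuples φ q` at `p`. Its columns are the
components of the vectors of `y` in the preferred chart at `φ p`. -/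
def fibreCoord (p : L) (y : Tuples φ q) : EuclideanSpace ℝ (Fin q) →L[ℝ] EM :=
  (trivializationAt (EuclideanSpace ℝ (Fin q) →L[ℝ] EM)
    ((φ : L → M) *ᵖ (TupleFibre q IM M)) p y).2

theorem fibreCoord_apply (p : L) (y : Tuples φ q) (a : EuclideanSpace ℝ (Fin q)) :
    fibreCoord φ q p y a =
      toCoord IM (φ p) (φ y.proj) ((show TupleFibre q IM M (φ y.proj) from y.2) a) := by
  have h : (trivializationAt (EuclideanSpace ℝ (Fin q))
      (Bundle.Trivial M (EuclideanSpace ℝ (Fin q))) (φ p)).symmL ℝ (φ y.proj) a = a := by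
    simp
  exact congrArg (fun a => toCoord IM (φ p) (φ y.proj)
    ((show TupleFibre q IM M (φ y.proj) from y.2) a)) h

theorem fibreCoord_single (p : L) (y : Tuples φ q) (α : Fin q) :
    fibreCoord φ q p y (EuclideanSpace.single α 1) =
      toCoord IM (φ p) (φ y.proj) (Tuples.vec φ y α) :=
  fibreCoord_apply p y _

theorem contMDiff_proj : ContMDiff (tuplesModel q IL EM) IL ∞ (fun y : Tuples φ q => y.proj) :=
  Bundle.contMDiff_proj _

theorem contMDiffAt_fibreCoord (x : Tuples φ q) :
    ContMDiffAt (tuplesModel q IL EM) 𝓘(ℝ, EuclideanSpace ℝ (Fin q) →L[ℝ] EM) ∞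
      (fibreCoord φ q x.proj) x :=
  (Bundle.contMDiffAt_totalSpace.1 (contMDiffAt_id (x := x))).2

theorem contMDiffAt_vec (x : Tuples φ q) (α : Fin q) :
    ContMDiffAt (tuplesModel q IL EM) IM.tangent ∞
      (fun y : Tuples φ q => (⟨φ y.proj, Tuples.vec φ y α⟩ : TangentBundle IM M)) x := by
  refine (contMDiffWithinAt_section_iff_toCoord (b := fun y : Tuples φ q => φ y.proj)
    (mem_chart_source HM (φ x.proj))).2 ⟨(φ.contMDiff.comp contMDiff_proj).contMDiffAt, ?_⟩
  simp only [← fibreCoord_single]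
  exact ContMDiffWithinAt.clm_apply (contMDiffAt_fibreCoord x) contMDiffWithinAt_const

end Tuples

section NewtonE

variable {EL : Type*} [NormedAddCommGroup EL] [NormedSpace ℝ EL] [FiniteDimensional ℝ EL]
  {HL : Type*} [TopologicalSpace HL] {IL : ModelWithCorners ℝ EL HL}
  {L : Type*} [TopologicalSpace L] [ChartedSpace HL L] [IsManifold IL ∞ L]
  [RiemannianBundle (fun p : L => TangentSpace IL p)]
  [IsContMDiffRiemannianBundle IL ∞ EL (fun p : L => TangentSpace IL p)]
  {EM : Type*} [NormedAddCommGroup EM] [NormedSpace ℝ EM] [FiniteDimensional ℝ EM]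
  {HM : Type*} [TopologicalSpace HM] {IM : ModelWithCorners ℝ EM HM}
  {M : Type*} [TopologicalSpace M] [ChartedSpace HM M] [IsManifold IM ∞ M]
  [RiemannianBundle (fun x : M => TangentSpace IM x)]
  [IsContMDiffRiemannianBundle IM ∞ EM (fun x : M => TangentSpace IM x)]
  {φ : C^∞⟮IL, L; IM, M⟯} {q : ℕ}

theorem newtonE_isSymmetric (hφ : IsIsometricImmersion φ) (u : Fin q →₀ ℕ) (x : Tuples φ q) :
    (newtonE φ u x).IsSymmetric :=
  newton_isSymmetric _ (fun _ => shape_isSymmetric hφ _ _) u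

/-- The section `T_u` of `End(E)` is smooth. -/
theorem contMDiffAt_newtonE_ofCoord (hφ : IsIsometricImmersion φ) (u : Fin q →₀ ℕ)
    (x : Tuples φ q) (v : EL) :
    ContMDiffAt (tuplesModel q IL EM) IL.tangent ∞ (fun y : Tuples φ q =>
      (⟨y.proj, newtonE φ u y (ofCoord IL x.proj y.proj v)⟩ : TangentBundle IL L)) x :=
  ContMDiffWithinAt.section_newton (b := fun y : Tuples φ q => y.proj)
    (mem_chart_source HL x.proj) contMDiff_proj.contMDiffAt
    (fun α v => contMDiffWithinAt_shape_ofCoord hφ (b := fun y : Tuples φ q => y.proj)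
      contMDiff_proj.contMDiffAt (contMDiffAt_vec x α) v) u v

end NewtonE

/-! ### The tangential connection -/

section TangentialConnection

variable {EL : Type*} [NormedAddCommGroup EL] [NormedSpace ℝ EL] [FiniteDimensional ℝ EL]
  {HL : Type*} [TopologicalSpace HL] {IL : ModelWithCorners ℝ EL HL}
  {L : Type*} [TopologicalSpace L] [ChartedSpace HL L] [IsManifold IL ∞ L]
  [RiemannianBundle (fun p : L => TangentSpace IL p)]
  {EM : Type*} [NormedAddCommGroup EM] [NormedSpace ℝ EM] [FiniteDimensional ℝ EM]
  {HM : Type*} [TopologicalSpace HM] {IM : ModelWithCorners ℝ EM HM}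
  {M : Type*} [TopologicalSpace M] [ChartedSpace HM M] [IsManifold IM ∞ M]
  [RiemannianBundle (fun x : M => TangentSpace IM x)]
  {φ : C^∞⟮IL, L; IM, M⟯}

/-- `∇^⊤` splits into the derivative of the components of `Y` and the derivative of the coordinate
field with the same value. So the pull-back of `∇^⊤` obeys the chain rule. -/
theorem connTang_eq_add_coordField (hφ : IsIsometricImmersion φ)
    {Y : ∀ p : L, TangentSpace IL p} {p : L}
    (hY : ContMDiffAt IL IL.tangent ∞ (fun p' => (⟨p', Y p'⟩ : TangentBundle IL L)) p)
    (X : TangentSpace IL p) :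
    connTang φ Y p X =
      ofCoord IL p p (mvfderiv IL (fun p' => toCoord IL p p' (Y p')) p X) +
        connTang φ (coordField IL p (Y p)) p X := by
  have hp := mem_chart_source HL p
  have hc := mem_chart_source HM (φ p)
  -- the differential of `φ` in charts
  let F : L → EL →L[ℝ] EM := fun p' =>
    toCoord IM (φ p) (φ p') ∘L mfderiv IL IM φ p' ∘L ofCoord IL p p'
  have hF : MDifferentiableAt IL 𝓘(ℝ, EL →L[ℝ] EM) F p := by
    refine ContMDiffAt.mdifferentiableAt (n := ∞) (contMDiffWithinAt_clm_of_apply fun v => ?_)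
      (by simp)
    exact ((contMDiffWithinAt_section_iff_toCoord (b := fun p => φ p) hc).1
      (ContMDiffWithinAt.section_diff (b := id) (contMDiffAt_section_ofCoord hp v))).2
  have hYc : MDifferentiableAt IL 𝓘(ℝ, EL) (fun p' => toCoord IL p p' (Y p')) p :=
    hY.mdifferentiableAt_toCoord (b := id) hp
  have hev (Z : ∀ p : L, TangentSpace IL p) :
      (fun p' => toCoord IM (φ p) (φ p') (diff φ p' (Z p'))) =ᶠ[𝓝 p]
        fun p' => F p' (toCoord IL p p' (Z p')) := by
    filter_upwards [(chartAt HL p).open_source.mem_nhds hp] with p' hp'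
    simp [F, ofCoord_toCoord hp', diff]
  have hev2 : (fun p' => F p' (toCoord IL p p' (coordField IL p (Y p) p'))) =ᶠ[𝓝 p]
      fun p' => F p' (toCoord IL p p (Y p)) := by
    filter_upwards [(chartAt HL p).open_source.mem_nhds hp] with p' hp'
    rw [toCoord_coordField hp']
  have h1 : connAlong φ (fun p' => diff φ p' (Y p')) p X =
      diff φ p (ofCoord IL p p (mvfderiv IL (fun p' => toCoord IL p p' (Y p')) p X)) +
        connAlong φ (fun p' => diff φ p' (coordField IL p (Y p) p')) p X := by
    rw [connAlong_apply, connAlong_apply, (hev Y).mvfderiv_eq, (hev _).mvfderiv_eq,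
      hev2.mvfderiv_eq, mvfderiv_clm_apply hF hYc, mvfderiv_clm_apply_const hF, coordField_self,
      map_add]
    have h2 (v : EL) : ofCoord IM (φ p) (φ p) (F p v) = diff φ p (ofCoord IL p p v) :=
      ofCoord_toCoord hc _
    rw [h2]
    abel
  change tang φ p _ = _ + tang φ p _
  rw [h1, map_add, tang_diff hφ]

/-- The connection `∇^⊤` is metric. -/
theorem mvfderiv_inner_eq_connTang
    [IsContMDiffRiemannianBundle IM ∞ EM (fun x : M => TangentSpace IM x)]
    (hφ : IsIsometricImmersion φ)
    {Y Z : ∀ p : L, TangentSpace IL p} {p : L}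
    (hY : ContMDiffAt IL IL.tangent ∞ (fun p' => (⟨p', Y p'⟩ : TangentBundle IL L)) p)
    (hZ : ContMDiffAt IL IL.tangent ∞ (fun p' => (⟨p', Z p'⟩ : TangentBundle IL L)) p)
    (X : TangentSpace IL p) :
    mvfderiv IL (fun p' => (⟪Y p', Z p'⟫ : ℝ)) p X =
      ⟪connTang φ Y p X, Z p⟫ + ⟪Y p, connTang φ Z p X⟫ := by
  have hY' : ContMDiffAt IL IM.tangent ∞
      (fun p' => (⟨φ p', diff φ p' (Y p')⟩ : TangentBundle IM M)) p :=
    ContMDiffWithinAt.section_diff (b := id) hY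
  have hZ' : ContMDiffAt IL IM.tangent ∞
      (fun p' => (⟨φ p', diff φ p' (Z p')⟩ : TangentBundle IM M)) p :=
    ContMDiffWithinAt.section_diff (b := id) hZ
  have h := mvfderiv_inner_eq_connAlong hY' hZ' X
  simp only [hφ _ _ _] at h
  rw [h]
  congr 1
  · exact (inner_tang p _ _).symm
  · rw [real_inner_comm, real_inner_comm _ (Y p)]
    exact (inner_tang p _ _).symm

end TangentialConnection

section Horizontal

variable {EL : Type*} [NormedAddCommGroup EL] [NormedSpace ℝ EL]
  {HL : Type*} [TopologicalSpace HL] {IL : ModelWithCorners ℝ EL HL}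
  {L : Type*} [TopologicalSpace L] [ChartedSpace HL L]
  {EN : Type*} [NormedAddCommGroup EN] [NormedSpace ℝ EN]
  {HN : Type*} [TopologicalSpace HN] {IN : ModelWithCorners ℝ EN HN}
  {N : Type*} [TopologicalSpace N] [ChartedSpace HN N]
  {F : Type*} [NormedAddCommGroup F] [NormedSpace ℝ F]

/-- A derivative within `P` in a direction tangent to a map into `P` is determined by the values on
`P`, although derivatives within `P` are not unique. -/
theorem mvfderivWithin_mfderiv_of_mem {γ : L → N} {P : Set N} {p : L} {g : N → F}
    (hP : ∀ᶠ p' in 𝓝 p, γ p' ∈ P) (hγ : MDifferentiableAt IL IN γ p)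
    (hg : MDifferentiableWithinAt IN 𝓘(ℝ, F) g P (γ p)) (X : TangentSpace IL p) :
    mvfderivWithin IN g P (γ p) (mfderiv IL IN γ p X) = mvfderiv IL (fun p' => g (γ p')) p X := by
  have h1 := (hg.hasMFDerivWithinAt.comp p (hγ.hasMFDerivAt.hasMFDerivWithinAt (s := γ ⁻¹' P))
    subset_rfl).hasMFDerivAt hP
  exact congrArg (fun A : EL →L[ℝ] F => A X) h1.mfderiv.symm

end Horizontal

/-! ### Horizontal vectors -/

section TangentTuples

variable {EL : Type*} [NormedAddCommGroup EL] [NormedSpace ℝ EL]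
  {HL : Type*} [TopologicalSpace HL] {IL : ModelWithCorners ℝ EL HL}
  {L : Type*} [TopologicalSpace L] [ChartedSpace HL L]
  {EM : Type*} [NormedAddCommGroup EM] [NormedSpace ℝ EM]
  {HM : Type*} [TopologicalSpace HM] {IM : ModelWithCorners ℝ EM HM}
  {M : Type*} [TopologicalSpace M] [ChartedSpace HM M] [IsManifold IM ∞ M]
  {φ : C^∞⟮IL, L; IM, M⟯} {q : ℕ}

/-- A tangent vector of `Tuples φ q` is determined by its projection to `L` and by the derivatives
of the fibre coordinates. -/
theorem eq_of_mfderiv_proj_eq_of_mvfderiv_fibreCoord_eq {x : Tuples φ q}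
    {ξ η : TangentSpace (tuplesModel q IL EM) x}
    (h1 : mfderiv (tuplesModel q IL EM) IL (fun y : Tuples φ q => y.proj) x ξ =
      mfderiv (tuplesModel q IL EM) IL (fun y : Tuples φ q => y.proj) x η)
    (h2 : ∀ α, mvfderiv (tuplesModel q IL EM) (fibreCoord φ q x.proj) x ξ
        (EuclideanSpace.single α 1) =
      mvfderiv (tuplesModel q IL EM) (fibreCoord φ q x.proj) x η (EuclideanSpace.single α 1)) :
    ξ = η := by
  have h2' : mvfderiv (tuplesModel q IL EM) (fibreCoord φ q x.proj) x ξ =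
      mvfderiv (tuplesModel q IL EM) (fibreCoord φ q x.proj) x η := by
    refine ContinuousLinearMap.coe_injective
      ((EuclideanSpace.basisFun (Fin q) ℝ).toBasis.ext fun α => ?_)
    simpa using h2 α
  let e := trivializationAt (EuclideanSpace ℝ (Fin q) →L[ℝ] EM)
    ((φ : L → M) *ᵖ (TupleFibre q IM M)) x.proj
  have hx : x ∈ e.source := by
    rw [e.mem_source]; exact mem_baseSet_trivializationAt _ _ _
  have hprod : ∀ᶠ y in 𝓝 x, e y = (y.proj, fibreCoord φ q x.proj y) := by
    filter_upwards [e.open_source.mem_nhds hx] with y hy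
    exact Prod.ext (e.coe_fst hy) rfl
  have hsymm : MDifferentiableAt (IL.prod 𝓘(ℝ, EuclideanSpace ℝ (Fin q) →L[ℝ] EM))
      (tuplesModel q IL EM) e.toOpenPartialHomeomorph.symm
        (x.proj, fibreCoord φ q x.proj x) := by
    have h3 := e.contMDiffOn_symm (IB := IL) (n := ∞)
    have h4 : e x ∈ e.target := e.map_source hx
    rw [hprod.self_of_nhds] at h4
    exact ((h3 _ h4).contMDiffAt (e.open_target.mem_nhds h4)).mdifferentiableAt (by simp)
  have hp : MDifferentiableAt (tuplesModel q IL EM) IL (fun y : Tuples φ q => y.proj) x :=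
    contMDiff_proj.contMDiffAt.mdifferentiableAt (by simp)
  have hf : MDifferentiableAt (tuplesModel q IL EM) 𝓘(ℝ, EuclideanSpace ℝ (Fin q) →L[ℝ] EM)
      (fibreCoord φ q x.proj) x := (contMDiffAt_fibreCoord x).mdifferentiableAt (by simp)
  have hid : (fun y => e.toOpenPartialHomeomorph.symm (y.proj, fibreCoord φ q x.proj y)) =ᶠ[𝓝 x]
      id := by
    filter_upwards [hprod, e.open_source.mem_nhds hx] with y hy hy'
    rw [← hy]; exact e.toOpenPartialHomeomorph.left_inv hy'
  have h5 := (hsymm.hasMFDerivAt.comp x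
    (hp.hasMFDerivAt.prodMk hf.hasMFDerivAt)).congr_of_eventuallyEq hid.symm
  -- the derivative of the trivialization is injective, as it has a left inverse
  have h6 := h5.mfderiv.symm.trans mfderiv_id
  have h7 (ζ) := congrArg (fun A : (EL × (EuclideanSpace ℝ (Fin q) →L[ℝ] EM)) →L[ℝ]
    (EL × (EuclideanSpace ℝ (Fin q) →L[ℝ] EM)) => A ζ) h6
  refine (h7 ξ).symm.trans (Eq.trans ?_ (h7 η))
  refine congrArg (mfderiv _ _ _ _) ?_
  exact Prod.ext h1 h2'

theorem mfderiv_proj_mfderiv_section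
    {s : ∀ p : L, ((φ : L → M) *ᵖ (TupleFibre q IM M)) p} {p : L}
    (hs : ContMDiffAt IL (tuplesModel q IL EM) ∞ (fun p' => (⟨p', s p'⟩ : Tuples φ q)) p)
    (X : TangentSpace IL p) :
    mfderiv (tuplesModel q IL EM) IL (fun y : Tuples φ q => y.proj) ⟨p, s p⟩
      (mfderiv IL (tuplesModel q IL EM) (fun p' => (⟨p', s p'⟩ : Tuples φ q)) p X) = X := by
  have h1 : MDifferentiableAt (tuplesModel q IL EM) IL (fun y : Tuples φ q => y.proj) ⟨p, s p⟩ :=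
    contMDiff_proj.contMDiffAt.mdifferentiableAt (by simp)
  have h2 := (h1.hasMFDerivAt.comp p (hs.mdifferentiableAt (by simp)).hasMFDerivAt).mfderiv
  have h3 := h2.symm.trans (mfderiv_id (I := IL) (x := p))
  exact congrArg (fun A : EL →L[ℝ] EL => A X) h3

end TangentTuples

section Horizontal

variable {EL : Type*} [NormedAddCommGroup EL] [NormedSpace ℝ EL] [FiniteDimensional ℝ EL]
  {HL : Type*} [TopologicalSpace HL] {IL : ModelWithCorners ℝ EL HL}
  {L : Type*} [TopologicalSpace L] [ChartedSpace HL L] [IsManifold IL ∞ L]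
  [RiemannianBundle (fun p : L => TangentSpace IL p)]
  {EM : Type*} [NormedAddCommGroup EM] [NormedSpace ℝ EM] [FiniteDimensional ℝ EM]
  {HM : Type*} [TopologicalSpace HM] {IM : ModelWithCorners ℝ EM HM}
  {M : Type*} [TopologicalSpace M] [ChartedSpace HM M] [IsManifold IM ∞ M]
  [RiemannianBundle (fun x : M => TangentSpace IM x)]
  {φ : C^∞⟮IL, L; IM, M⟯} {q : ℕ} {P : Set (Tuples φ q)}
  {s : ∀ p : L, ((φ : L → M) *ᵖ (TupleFibre q IM M)) p} {p : L}

/-- Along a local section of `P`, the connection `∇^E` is `∇^⊤`. -/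
theorem connE_mfderiv_section (hφ : IsIsometricImmersion φ)
    (hP : ∀ᶠ p' in 𝓝 p, (⟨p', s p'⟩ : Tuples φ q) ∈ P)
    (hs : ContMDiffAt IL (tuplesModel q IL EM) ∞ (fun p' => (⟨p', s p'⟩ : Tuples φ q)) p)
    {U : ∀ y : Tuples φ q, TangentSpace IL y.proj}
    (hU : ContMDiffWithinAt (tuplesModel q IL EM) IL.tangent ∞
      (fun y => (⟨y.proj, U y⟩ : TangentBundle IL L)) P ⟨p, s p⟩) (X : TangentSpace IL p) :
    connE φ P U ⟨p, s p⟩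
      (mfderiv IL (tuplesModel q IL EM) (fun p' => (⟨p', s p'⟩ : Tuples φ q)) p X) =
    connTang φ (fun p' => U ⟨p', s p'⟩) p X := by
  have hp := mem_chart_source HL p
  have hUs : ContMDiffAt IL IL.tangent ∞
      (fun p' => (⟨p', U ⟨p', s p'⟩⟩ : TangentBundle IL L)) p :=
    (hU.comp p (hs.contMDiffWithinAt (s := (fun p' => (⟨p', s p'⟩ : Tuples φ q)) ⁻¹' P))
      fun _ h => h).contMDiffAt hP
  rw [connTang_eq_add_coordField hφ hUs]
  have h1 : MDifferentiableWithinAt (tuplesModel q IL EM) 𝓘(ℝ, EL)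
      (fun y : Tuples φ q => toCoord IL p y.proj (U y)) P ⟨p, s p⟩ :=
    (((contMDiffWithinAt_section_iff_toCoord (b := fun y : Tuples φ q => y.proj) (c := p)
      hp).1 hU).2).mdifferentiableWithinAt (by simp)
  have h2 := mvfderivWithin_mfderiv_of_mem hP (hs.mdifferentiableAt (by simp)) h1 X
  rw [← h2]
  change _ + connTang φ (coordField IL p (U ⟨p, s p⟩)) p (mfderiv (tuplesModel q IL EM) IL
    (fun y : Tuples φ q => y.proj) ⟨p, s p⟩ _) = _
  rw [mfderiv_proj_mfderiv_section hs]
  rfl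

/-- The derivatives of the fibre coordinates in a horizontal direction depend linearly on its
projection `X`, since the frame vectors satisfy `∇_X e_α = -dφ(A^{e_α} X)`. -/
theorem mvfderiv_fibreCoord_mfderiv_section (hφ : IsIsometricImmersion φ)
    [IsContMDiffRiemannianBundle IM ∞ EM (fun x : M => TangentSpace IM x)]
    [IsContMDiffRiemannianBundle IL ∞ EL (fun p : L => TangentSpace IL p)]
    (hP : ∀ᶠ p' in 𝓝 p, (⟨p', s p'⟩ : Tuples φ q) ∈ orthonormalFrames φ q)
    (hs : ContMDiffAt IL (tuplesModel q IL EM) ∞ (fun p' => (⟨p', s p'⟩ : Tuples φ q)) p)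
    {X : TangentSpace IL p}
    (hX : ∀ α, connNor φ (fun p' => Tuples.vec φ ⟨p', s p'⟩ α) p X = 0) (α : Fin q) :
    mvfderiv (tuplesModel q IL EM) (fibreCoord φ q p) (⟨p, s p⟩ : Tuples φ q)
      (mfderiv IL (tuplesModel q IL EM) (fun p' => (⟨p', s p'⟩ : Tuples φ q)) p X)
      (EuclideanSpace.single α 1) =
    toCoord IM (φ p) (φ p) (-diff φ p (shape φ p (Tuples.vec φ ⟨p, s p⟩ α) X) -
      christoffel IM (φ p) (Tuples.vec φ ⟨p, s p⟩ α) (diff φ p X)) := by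
  have hc := mem_chart_source HM (φ p)
  have hV : ContMDiffAt IL IM.tangent ∞
      (fun p' => (⟨φ p', Tuples.vec φ ⟨p', s p'⟩ α⟩ : TangentBundle IM M)) p :=
    (contMDiffAt_vec (⟨p, s p⟩ : Tuples φ q) α).comp p hs
  have h1 := connAlong_eq_neg_shape_of_connNor_eq_zero hφ hV
    (hP.mono fun p' hp' => hp'.2 α) (hX α)
  have hf : MDifferentiableAt (tuplesModel q IL EM) 𝓘(ℝ, EuclideanSpace ℝ (Fin q) →L[ℝ] EM)
      (fibreCoord φ q p) (⟨p, s p⟩ : Tuples φ q) :=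
    (contMDiffAt_fibreCoord (⟨p, s p⟩ : Tuples φ q)).mdifferentiableAt (by simp)
  have hs' := hs.mdifferentiableAt (by simp)
  have h2 := mvfderiv_comp_apply' (f := fun p' => (⟨p', s p'⟩ : Tuples φ q)) p hf hs' X
  have hfs : MDifferentiableAt IL 𝓘(ℝ, EuclideanSpace ℝ (Fin q) →L[ℝ] EM)
      (fun p' => fibreCoord φ q p (⟨p', s p'⟩ : Tuples φ q)) p :=
    MDifferentiableAt.comp (g := fibreCoord φ q p) p hf hs'
  rw [← h2, ← h1, connAlong_apply, add_sub_cancel_right, toCoord_ofCoord hc,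
    ← mvfderiv_clm_apply_const hfs]
  simp only [fibreCoord_single]

end Horizontal

/-! ### Local frames of the normal bundle that are parallel in one direction -/

section SquareRoot

variable {A : Type*} [NormedRing A] [NormedAlgebra ℝ A] [CompleteSpace A] [StarRing A]
  [ContinuousStar A]

/-- Near the identity of a Banach *-algebra there is a smooth function whose values at selfadjoint
elements `a` are selfadjoint and play the role of `a ^ (-1 / 2)`: the inverse of a local inverse of
the squaring map. -/
theorem exists_contDiffAt_inv_sqrt : ∃ r : A → A, ContDiffAt ℝ ∞ r 1 ∧ r 1 = 1 ∧
    ∀ᶠ a in 𝓝 (1 : A), IsSelfAdjoint a → IsSelfAdjoint (r a) ∧ r a * a * r a = 1 := by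
  have hsq : ContDiffAt ℝ ∞ (fun a : A => a * a) 1 := contDiffAt_id.mul contDiffAt_id
  let f' : A ≃L[ℝ] A := ContinuousLinearEquiv.smulLeft (Units.mk0 (2 : ℝ) two_ne_zero)
  have hf' : HasFDerivAt (fun a : A => a * a) (f' : A →L[ℝ] A) 1 := by
    refine ((hasFDerivAt_id (𝕜 := ℝ) (1 : A)).mul' (hasFDerivAt_id (1 : A))).congr_fderiv ?_
    ext a
    simp [f', two_smul, Units.smul_def]
  have hn : (∞ : WithTop ℕ∞) ≠ 0 := by simp
  have hst := hsq.hasStrictFDerivAt' hf' hn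
  let g := hsq.localInverse hf' hn
  have hg1 : g 1 = 1 := by
    have := hsq.localInverse_apply_image hf' hn
    rwa [mul_one] at this
  have hg : ContDiffAt ℝ ∞ g 1 := by
    have := hsq.to_localInverse hf' hn
    rwa [mul_one] at this
  have hl : ∀ᶠ a in 𝓝 (1 : A), g (a * a) = a := hst.eventually_left_inverse
  have hr : ∀ᶠ a in 𝓝 (1 : A), g a * g a = a := by
    have := hst.eventually_right_inverse
    rwa [mul_one] at this
  have hgi : Tendsto g (𝓝 1) (𝓝 1) := by
    have := hg.continuousAt.tendsto
    rwa [hg1] at this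
  have hgs : Tendsto (fun a => star (g a)) (𝓝 1) (𝓝 1) := by
    have := (continuous_star.tendsto (1 : A)).comp hgi
    rwa [star_one] at this
  refine ⟨fun a => Ring.inverse (g a), ?_, by simp [hg1], ?_⟩
  · refine ContDiffAt.comp (g := Ring.inverse) 1 ?_ hg
    rw [hg1]
    exact contDiffAt_ringInverse ℝ (1 : Aˣ)
  · filter_upwards [hr, hgs.eventually hl, hgi.eventually (Units.nhds (1 : Aˣ))] with a h1 h2 h3 ha
    -- `star (g a)` is a square root of `a` close to `1`, so that it is `g a`
    have hs : star (g a) = g a := by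
      rw [← h2, ← star_mul, h1, ha.star_eq]
    refine ⟨(Ring.inverse_star (g a)).symm.trans (congrArg _ hs), ?_⟩
    have hu : IsUnit (g a) := h3
    calc Ring.inverse (g a) * a * Ring.inverse (g a)
        = Ring.inverse (g a) * (g a * g a) * Ring.inverse (g a) := by rw [h1]
      _ = (Ring.inverse (g a) * g a) * (g a * Ring.inverse (g a)) := by simp only [mul_assoc]
      _ = 1 := by rw [Ring.inverse_mul_cancel _ hu, Ring.mul_inverse_cancel _ hu, one_mul]

end SquareRoot

section Cutoff

variable {EL : Type*} [NormedAddCommGroup EL] [NormedSpace ℝ EL] 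
  {HL : Type*} [TopologicalSpace HL] {IL : ModelWithCorners ℝ EL HL}
  {L : Type*} [TopologicalSpace L] [ChartedSpace HL L] [IsManifold IL ∞ L]

/-- A function with value `0` at `p` and derivative `1` in a given nonzero direction. -/
theorem exists_contMDiffAt_mvfderiv_eq_one (p : L) {X : TangentSpace IL p} (hX : X ≠ 0) :
    ∃ h : L → ℝ, ContMDiffAt IL 𝓘(ℝ, ℝ) ∞ h p ∧ h p = 0 ∧ mvfderiv IL h p X = 1 := by
  have hp := mem_chart_source HL p
  have hinv := isInvertible_mfderiv_extChartAt (I := IL) (x := p) (y := p) (mem_extChartAt_source p)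
  have hne : (mvfderiv IL (extChartAt IL p) p X : EL) ≠ 0 := by
    intro h0
    exact hX (hinv.injective (h0.trans (map_zero _).symm))
  obtain ⟨ℓ, hℓ⟩ := SeparatingDual.exists_eq_one (R := ℝ) hne
  have hc : ContMDiffAt IL 𝓘(ℝ, EL) ∞ (extChartAt IL p) p := contMDiffAt_extChartAt
  have hd : ContMDiffAt IL 𝓘(ℝ, EL) ∞ (fun y => extChartAt IL p y - extChartAt IL p p) p :=
    hc.sub contMDiffAt_const
  refine ⟨fun y => ℓ (extChartAt IL p y - extChartAt IL p p),
    ℓ.contMDiff.contMDiffAt.comp p hd, by simp, ?_⟩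
  rw [mvfderiv_clm_const_apply ℓ (hd.mdifferentiableAt (by simp))]
  rw [mvfderiv_fun_sub (hc.mdifferentiableAt (by simp)) mdifferentiableAt_const, mvfderiv_const,
    sub_zero]
  exact hℓ

end Cutoff

section NormalFields

variable {EL : Type*} [NormedAddCommGroup EL] [NormedSpace ℝ EL] [FiniteDimensional ℝ EL]
  {HL : Type*} [TopologicalSpace HL] {IL : ModelWithCorners ℝ EL HL}
  {L : Type*} [TopologicalSpace L] [ChartedSpace HL L]
  [RiemannianBundle (fun p : L => TangentSpace IL p)]
  {EM : Type*} [NormedAddCommGroup EM] [NormedSpace ℝ EM] [FiniteDimensional ℝ EM]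
  {HM : Type*} [TopologicalSpace HM] {IM : ModelWithCorners ℝ EM HM}
  {M : Type*} [TopologicalSpace M] [ChartedSpace HM M] [IsManifold IM ∞ M]
  [RiemannianBundle (fun x : M => TangentSpace IM x)]
  [IsContMDiffRiemannianBundle IM ∞ EM (fun x : M => TangentSpace IM x)]
  {φ : C^∞⟮IL, L; IM, M⟯}

/-- Linear combinations, with coefficients stationary in the direction `X`, of normal fields that
are parallel in the direction `X` are parallel in that direction. -/
theorem connNor_sum_smul_eq_zero {κ : Type*} (t : Finset κ) {V : κ → ∀ p : L, TangentSpace IM (φ p)}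
    {f : κ → L → ℝ} {p : L} {X : TangentSpace IL p}
    (hf : ∀ k, ContMDiffAt IL 𝓘(ℝ, ℝ) ∞ (f k) p) (hfX : ∀ k, mvfderiv IL (f k) p X = 0)
    (hV : ∀ k, ContMDiffAt IL IM.tangent ∞ (fun p => (⟨φ p, V k p⟩ : TangentBundle IM M)) p)
    (hVX : ∀ k, connNor φ (V k) p X = 0) :
    ContMDiffAt IL IM.tangent ∞
        (fun p => (⟨φ p, ∑ k ∈ t, f k p • V k p⟩ : TangentBundle IM M)) p ∧
      connNor φ (fun p => ∑ k ∈ t, f k p • V k p) p X = 0 := by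
  classical
  induction t using Finset.induction_on with
  | empty =>
    simp only [Finset.sum_empty]
    refine ⟨contMDiffWithinAt_section_zero (b := fun p => φ p) φ.contMDiff.contMDiffAt, ?_⟩
    have h0 : christoffel IM (φ p) 0 = 0 := LinearMap.ext fun u =>
      (christoffel_symm IM (φ p) u 0).trans (map_zero _)
    change nor φ p (connAlong φ _ p X) = 0
    rw [connAlong_apply]
    simp only [map_zero, h0, mvfderiv_const]
    simp
  | insert k t hk ih =>
    simp only [Finset.sum_insert hk]
    have h1 := ContMDiffWithinAt.section_smul (b := fun p => φ p) (hf k) (hV k)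
    refine ⟨ContMDiffWithinAt.section_add (b := fun p => φ p) h1 ih.1, ?_⟩
    change nor φ p (connAlong φ (fun p => f k p • V k p + ∑ k ∈ t, f k p • V k p) p X) = 0
    rw [connAlong_add h1 ih.1, map_add, connAlong_smul ((hf k).mdifferentiableAt (by simp)) (hV k),
      hfX, zero_smul, zero_add, map_smul]
    rw [show nor φ p (connAlong φ (V k) p X) = 0 from hVX k, smul_zero, zero_add]
    exact ih.2

variable [IsManifold IL ∞ L] [IsContMDiffRiemannianBundle IL ∞ EL (fun p : L => TangentSpace IL p)]

/-- A normal vector extends to a normal field that is parallel in the direction `X`. -/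
theorem exists_normal_field_connNor_eq_zero (hφ : IsIsometricImmersion φ) {p : L}
    {w : TangentSpace IM (φ p)} (hw : ∀ X : TangentSpace IL p, ⟪w, diff φ p X⟫ = 0)
    (X : TangentSpace IL p) :
    ∃ V : ∀ p' : L, TangentSpace IM (φ p'),
      ContMDiffAt IL IM.tangent ∞ (fun p' => (⟨φ p', V p'⟩ : TangentBundle IM M)) p ∧
      (∀ p' (Z : TangentSpace IL p'), ⟪V p', diff φ p' Z⟫ = 0) ∧ V p = w ∧
      connNor φ V p X = 0 := by
  have hV := contMDiffAt_normalExt p w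
  by_cases hX : X = 0
  · exact ⟨normalExt φ p w, hV, fun p' Z => inner_nor_diff hφ p' _ Z,
      (normalExt_self p w).trans (nor_eq_self hw), by rw [hX, map_zero]⟩
  obtain ⟨h, hh, hp, hX1⟩ := exists_contMDiffAt_mvfderiv_eq_one p hX
  have hv := contMDiffAt_normalExt p (-connNor φ (normalExt φ p w) p X)
  have h1 := ContMDiffWithinAt.section_smul (b := fun p => φ p) hh hv
  -- `h` vanishes at `p` and `dh X = 1`, so that the second summand cancels `∇^⊥_X` of the first
  refine ⟨fun p' => normalExt φ p w p' +
    h p' • normalExt φ p (-connNor φ (normalExt φ p w) p X) p',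
    ContMDiffWithinAt.section_add (b := fun p => φ p) hV h1, fun p' Z => ?_, ?_, ?_⟩
  · rw [inner_add_left, inner_smul_left, normalExt, normalExt, inner_nor_diff hφ,
      inner_nor_diff hφ]
    simp
  · beta_reduce
    rw [hp, zero_smul, add_zero]
    exact (normalExt_self p w).trans (nor_eq_self hw)
  · have h2 : nor φ p (connNor φ (normalExt φ p w) p X) = connNor φ (normalExt φ p w) p X :=
      nor_eq_self fun Z => inner_nor_diff hφ p _ Z
    change nor φ p _ = 0
    rw [connAlong_add hV h1, map_add, connAlong_smul (hh.mdifferentiableAt (by simp)) hv, hX1, hp,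
      zero_smul, one_smul, add_zero, normalExt_self, map_neg, map_neg, h2, h2]
    exact add_neg_cancel _

end NormalFields

section Frames

variable {EL : Type*} [NormedAddCommGroup EL] [NormedSpace ℝ EL]
  {HL : Type*} [TopologicalSpace HL] {IL : ModelWithCorners ℝ EL HL}
  {L : Type*} [TopologicalSpace L] [ChartedSpace HL L]
  {EM : Type*} [NormedAddCommGroup EM] [NormedSpace ℝ EM]
  {HM : Type*} [TopologicalSpace HM] {IM : ModelWithCorners ℝ EM HM}
  {M : Type*} [TopologicalSpace M] [ChartedSpace HM M]   {φ : C^∞⟮IL, L; IM, M⟯} {q : ℕ}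

/-- The tuple of vectors `w_1, …, w_q` at `p`, as an element of the fibre of `Tuples φ q`: the map
`a ↦ ∑ α, a_α w_α`. -/
def tupleOf {p : L} (w : Fin q → TangentSpace IM (φ p)) :
    ((φ : L → M) *ᵖ (TupleFibre q IM M)) p :=
  (∑ α, (EuclideanSpace.proj α : EuclideanSpace ℝ (Fin q) →L[ℝ] ℝ).smulRight (w α) :
    EuclideanSpace ℝ (Fin q) →L[ℝ] TangentSpace IM (φ p))

theorem tupleOf_apply {p : L} (w : Fin q → TangentSpace IM (φ p)) (a : EuclideanSpace ℝ (Fin q)) :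
    (show EuclideanSpace ℝ (Fin q) →L[ℝ] TangentSpace IM (φ p) from tupleOf w) a =
      ∑ α, a α • w α := by
  change (∑ α, (EuclideanSpace.proj α : EuclideanSpace ℝ (Fin q) →L[ℝ] ℝ).smulRight (w α) :
    EuclideanSpace ℝ (Fin q) →L[ℝ] TangentSpace IM (φ p)) a = _
  simp

theorem vec_tupleOf {p : L} (w : Fin q → TangentSpace IM (φ p)) (α : Fin q) :
    Tuples.vec φ ⟨p, tupleOf w⟩ α = w α := by
  refine (tupleOf_apply w _).trans ?_
  simp [PiLp.single_apply]

theorem tupleOf_vec {p : L} (f : ((φ : L → M) *ᵖ (TupleFibre q IM M)) p) :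
    tupleOf (fun α => Tuples.vec φ ⟨p, f⟩ α) = f := by
  let f' : EuclideanSpace ℝ (Fin q) →L[ℝ] TangentSpace IM (φ p) := f
  let g' : EuclideanSpace ℝ (Fin q) →L[ℝ] TangentSpace IM (φ p) :=
    tupleOf (fun α => Tuples.vec φ ⟨p, f⟩ α)
  suffices h : g' = f' from h
  refine ContinuousLinearMap.coe_injective
      ((EuclideanSpace.basisFun (Fin q) ℝ).toBasis.ext fun α => ?_)
  rw [OrthonormalBasis.coe_toBasis, EuclideanSpace.basisFun_apply]
  exact vec_tupleOf (fun α => Tuples.vec φ ⟨p, f⟩ α) α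

theorem contMDiffAt_tupleOf [IsManifold IM ∞ M]
    {W : Fin q → ∀ p : L, TangentSpace IM (φ p)} {p : L}
    (hW : ∀ α, ContMDiffAt IL IM.tangent ∞
      (fun p' => (⟨φ p', W α p'⟩ : TangentBundle IM M)) p) :
    ContMDiffAt IL (tuplesModel q IL EM) ∞
      (fun p' => (⟨p', tupleOf fun α => W α p'⟩ : Tuples φ q)) p := by
  have hc := mem_chart_source HM (φ p)
  refine Bundle.contMDiffAt_totalSpace.2 ⟨contMDiffAt_id, ?_⟩
  refine contMDiffWithinAt_clm_of_apply fun a => ?_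
  change ContMDiffAt IL 𝓘(ℝ, EM) ∞ (fun p' =>
    fibreCoord φ q p (⟨p', tupleOf fun α => W α p'⟩ : Tuples φ q) a) p
  have h (p' : L) : fibreCoord φ q p (⟨p', tupleOf fun α => W α p'⟩ : Tuples φ q) a =
      ∑ α, a α • toCoord IM (φ p) (φ p') (W α p') := by
    rw [fibreCoord_apply]
    refine (congrArg (toCoord IM (φ p) (φ p')) (tupleOf_apply _ a)).trans ?_
    simp only [map_sum, map_smul]
  simp only [h]
  exact contMDiffWithinAt_finsetSum fun α _ =>
    ContMDiffWithinAt.smul (f := fun _ => (a α : ℝ)) (contMDiffWithinAt_const (I' := 𝓘(ℝ, ℝ)))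
    ((contMDiffWithinAt_section_iff_toCoord (b := fun p => φ p) hc).1 (hW α)).2

end Frames

section Gram

variable {F : Type*} [NormedAddCommGroup F] [InnerProductSpace ℝ F] {q : ℕ}

/-- The Gram matrix of `w_1, …, w_q`, as an endomorphism of `ℝ^q`. -/
def gramOp (w : Fin q → F) :
    EuclideanSpace ℝ (Fin q) →L[ℝ] EuclideanSpace ℝ (Fin q) :=
  ∑ α, ∑ β, (⟪w α, w β⟫ : ℝ) •
    (EuclideanSpace.proj α : EuclideanSpace ℝ (Fin q) →L[ℝ] ℝ).smulRight
      (EuclideanSpace.single β (1 : ℝ))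

theorem inner_gramOp (w : Fin q → F)
    (a b : EuclideanSpace ℝ (Fin q)) :
    (⟪gramOp w a, b⟫ : ℝ) = ⟪∑ α, a α • w α, ∑ β, b β • w β⟫ := by
  simp only [gramOp, sum_apply, smul_apply, sum_inner, inner_sum, inner_smul_left,
    inner_smul_right, ContinuousLinearMap.smulRight_apply, EuclideanSpace.inner_single_left]
  rw [Finset.sum_comm]
  refine Finset.sum_congr rfl fun β _ => ?_
  rw [Finset.mul_sum]
  refine Finset.sum_congr rfl fun α _ => ?_
  simp
  ring

theorem gramOp_single (w : Fin q → F)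
    (α β : Fin q) : gramOp w (EuclideanSpace.single α 1) β = ⟪w α, w β⟫ := by
  have h := inner_gramOp w (EuclideanSpace.single α 1) (EuclideanSpace.single β 1)
  simpa [EuclideanSpace.inner_single_right, PiLp.single_apply] using h

theorem isSelfAdjoint_gramOp (w : Fin q → F) : IsSelfAdjoint (gramOp w) := by
  rw [ContinuousLinearMap.isSelfAdjoint_iff_isSymmetric]
  intro a b
  change (⟪gramOp w a, b⟫ : ℝ) = ⟪a, gramOp w b⟫
  rw [real_inner_comm (gramOp w b) a, inner_gramOp, inner_gramOp, real_inner_comm]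

theorem gramOp_eq_one {w : Fin q → F} (hw : Orthonormal ℝ w) : gramOp w = 1 := by
  ext a : 1
  refine ext_inner_right ℝ fun b => ?_
  rw [inner_gramOp, hw.inner_sum]
  simp [PiLp.inner_apply, mul_comm]

end Gram

section ParallelFrames

variable {EL : Type*} [NormedAddCommGroup EL] [NormedSpace ℝ EL] [FiniteDimensional ℝ EL]
  {HL : Type*} [TopologicalSpace HL] {IL : ModelWithCorners ℝ EL HL}
  {L : Type*} [TopologicalSpace L] [ChartedSpace HL L]
  [RiemannianBundle (fun p : L => TangentSpace IL p)]
  {EM : Type*} [NormedAddCommGroup EM] [NormedSpace ℝ EM] [FiniteDimensional ℝ EM]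
  {HM : Type*} [TopologicalSpace HM] {IM : ModelWithCorners ℝ EM HM}
  {M : Type*} [TopologicalSpace M] [ChartedSpace HM M] [IsManifold IM ∞ M]
  [RiemannianBundle (fun x : M => TangentSpace IM x)]
  {φ : C^∞⟮IL, L; IM, M⟯} {q : ℕ}

theorem inner_connAlong_eq_inner_connNor {V : ∀ p : L, TangentSpace IM (φ p)} {p : L}
    {w : TangentSpace IM (φ p)} (hw : ∀ X : TangentSpace IL p, ⟪w, diff φ p X⟫ = 0)
    (X : TangentSpace IL p) : (⟪connNor φ V p X, w⟫ : ℝ) = ⟪connAlong φ V p X, w⟫ := by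
  change (⟪connAlong φ V p X - diff φ p (tang φ p (connAlong φ V p X)), w⟫ : ℝ) = _
  rw [inner_sub_left, real_inner_comm w (diff φ p _), hw, sub_zero]

variable [IsContMDiffRiemannianBundle IM ∞ EM (fun x : M => TangentSpace IM x)]

/-- Fields that are orthonormal at `p` and parallel there in the direction `X` can be made
orthonormal near `p`, keeping both properties: multiply by `G ^ (-1 / 2)`, where `G` is their Gram matrix. -/
theorem exists_orthonormal_frame_of_orthonormal {V : Fin q → ∀ p : L, TangentSpace IM (φ p)} {p : L}
    {X : TangentSpace IL p}
    (hV : ∀ α, ContMDiffAt IL IM.tangent ∞ (fun p => (⟨φ p, V α p⟩ : TangentBundle IM M)) p)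
    (hn : ∀ α p' (Z : TangentSpace IL p'), ⟪V α p', diff φ p' Z⟫ = 0)
    (ho : Orthonormal ℝ (fun α => V α p)) (hX : ∀ α, connNor φ (V α) p X = 0) :
    ∃ W : Fin q → ∀ p : L, TangentSpace IM (φ p),
      (∀ α, ContMDiffAt IL IM.tangent ∞ (fun p => (⟨φ p, W α p⟩ : TangentBundle IM M)) p) ∧
      (∀ α p' (Z : TangentSpace IL p'), ⟪W α p', diff φ p' Z⟫ = 0) ∧
      (∀ α, W α p = V α p) ∧ (∀ᶠ p' in 𝓝 p, Orthonormal ℝ (fun α => W α p')) ∧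
      ∀ α, connNor φ (W α) p X = 0 := by
  obtain ⟨r, hr, hr1, hrs⟩ :=
    exists_contDiffAt_inv_sqrt (A := EuclideanSpace ℝ (Fin q) →L[ℝ] EuclideanSpace ℝ (Fin q))
  let G : L → EuclideanSpace ℝ (Fin q) →L[ℝ] EuclideanSpace ℝ (Fin q) :=
    fun p' => gramOp fun α => V α p'
  have hinner (α β : Fin q) : ContMDiffAt IL 𝓘(ℝ, ℝ) ∞ (fun p' => (⟪V α p', V β p'⟫ : ℝ)) p :=
    ContMDiffWithinAt.inner_section (b := fun p => φ p) (hV α) (hV β)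
  have hG1 : G p = 1 := gramOp_eq_one ho
  have hG : ContMDiffAt IL 𝓘(ℝ, EuclideanSpace ℝ (Fin q) →L[ℝ] EuclideanSpace ℝ (Fin q)) ∞ G p :=
    contMDiffWithinAt_finsetSum fun α _ => contMDiffWithinAt_finsetSum fun β _ =>
      ContMDiffWithinAt.smul (hinner α β) contMDiffWithinAt_const
  let ev : Fin q → Fin q → (EuclideanSpace ℝ (Fin q) →L[ℝ] EuclideanSpace ℝ (Fin q)) →L[ℝ] ℝ :=
    fun α β => (EuclideanSpace.proj β : EuclideanSpace ℝ (Fin q) →L[ℝ] ℝ) ∘L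
      (ContinuousLinearMap.apply ℝ _ (EuclideanSpace.single α (1 : ℝ)))
  -- the Gram matrix is stationary at `p` in the direction `X`, as the fields are parallel
  have hGX : mvfderiv IL G p X = 0 := by
    refine ContinuousLinearMap.coe_injective
      ((EuclideanSpace.basisFun (Fin q) ℝ).toBasis.ext fun α => ?_)
    ext β
    have h1 := mvfderiv_clm_const_apply (ev α β) (hG.mdifferentiableAt (by simp)) X
    have h2 : (fun p' => ev α β (G p')) = fun p' => (⟪V α p', V β p'⟫ : ℝ) :=
      funext fun p' => gramOp_single _ α β
    rw [h2, mvfderiv_inner_eq_connAlong (hV α) (hV β), real_inner_comm _ (V α p),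
      ← inner_connAlong_eq_inner_connNor (hn β p), ← inner_connAlong_eq_inner_connNor (hn α p),
      hX, hX, inner_zero_left, inner_zero_left, add_zero] at h1
    rw [OrthonormalBasis.coe_toBasis, EuclideanSpace.basisFun_apply]
    exact h1.symm
  have hr' : ContMDiffAt 𝓘(ℝ, EuclideanSpace ℝ (Fin q) →L[ℝ] EuclideanSpace ℝ (Fin q))
      𝓘(ℝ, EuclideanSpace ℝ (Fin q) →L[ℝ] EuclideanSpace ℝ (Fin q)) ∞ r (G p) := by
    rw [hG1]; exact hr.contMDiffAt
  have hrG : ContMDiffAt IL 𝓘(ℝ, EuclideanSpace ℝ (Fin q) →L[ℝ] EuclideanSpace ℝ (Fin q)) ∞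
      (fun p' => r (G p')) p := hr'.comp p hG
  let f : Fin q → Fin q → L → ℝ := fun α β p' => r (G p') (EuclideanSpace.single α 1) β
  have hf (α β : Fin q) : ContMDiffAt IL 𝓘(ℝ, ℝ) ∞ (f α β) p :=
    (ev α β).contMDiff.contMDiffAt.comp p hrG
  have hfX (α β : Fin q) : mvfderiv IL (f α β) p X = 0 := by
    have h1 := mvfderiv_clm_const_apply (ev α β) (hrG.mdifferentiableAt (by simp)) X
    have h2 := mvfderiv_comp_apply' (f := G) p (hr'.mdifferentiableAt (by simp))
      (hG.mdifferentiableAt (by simp)) X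
    refine h1.trans ?_
    rw [h2]
    exact (congrArg (fun A => ev α β (mvfderiv 𝓘(ℝ, EuclideanSpace ℝ (Fin q) →L[ℝ]
      EuclideanSpace ℝ (Fin q)) r (G p) A)) hGX).trans
      ((congrArg (ev α β) (ContinuousLinearMap.map_zero _)).trans (map_zero _))
  have hW (α : Fin q) := connNor_sum_smul_eq_zero Finset.univ (hf α) (hfX α) hV hX
  refine ⟨fun α p' => ∑ β, f α β p' • V β p', fun α => (hW α).1, fun α p' Z => ?_, fun α => ?_, ?_,
    fun α => (hW α).2⟩
  · simp [sum_inner, inner_smul_left, hn]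
  · simp [f, hG1, hr1, PiLp.single_apply]
  · have hGt : Tendsto G (𝓝 p) (𝓝 1) := hG1 ▸ hG.continuousAt.tendsto
    filter_upwards [hGt.eventually hrs] with p' hp'
    obtain ⟨hs, h1⟩ := hp' (isSelfAdjoint_gramOp _)
    rw [orthonormal_iff_ite]
    intro α β
    have h2 := inner_gramOp (fun α => V α p') (r (G p') (EuclideanSpace.single α 1))
      (r (G p') (EuclideanSpace.single β 1))
    refine h2.symm.trans ?_
    have h3 := (ContinuousLinearMap.isSelfAdjoint_iff_isSymmetric.1 hs)
      (G p' (r (G p') (EuclideanSpace.single α 1))) (EuclideanSpace.single β 1)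
    refine h3.symm.trans ?_
    have h4 : r (G p') (G p' (r (G p') (EuclideanSpace.single α 1))) = EuclideanSpace.single α 1 :=
      congrArg (fun A : EuclideanSpace ℝ (Fin q) →L[ℝ] EuclideanSpace ℝ (Fin q) =>
        A (EuclideanSpace.single α 1)) h1
    refine (congrArg (fun a => (⟪a, EuclideanSpace.single β (1 : ℝ)⟫ : ℝ)) h4).trans ?_
    simp [EuclideanSpace.inner_single_left, PiLp.single_apply]

end ParallelFrames

/-! ### Covariant derivatives of endomorphisms -/

section EndDerivative

variable {EL : Type*} [NormedAddCommGroup EL] [NormedSpace ℝ EL] [FiniteDimensional ℝ EL]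
  {HL : Type*} [TopologicalSpace HL] {IL : ModelWithCorners ℝ EL HL}
  {L : Type*} [TopologicalSpace L] [ChartedSpace HL L] [IsManifold IL ∞ L]
  [RiemannianBundle (fun p : L => TangentSpace IL p)]
  {EM : Type*} [NormedAddCommGroup EM] [NormedSpace ℝ EM] [FiniteDimensional ℝ EM]
  {HM : Type*} [TopologicalSpace HM] {IM : ModelWithCorners ℝ EM HM}
  {M : Type*} [TopologicalSpace M] [ChartedSpace HM M] [IsManifold IM ∞ M]
  [RiemannianBundle (fun x : M => TangentSpace IM x)]
  {φ : C^∞⟮IL, L; IM, M⟯}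
  {T : ∀ p : L, Module.End ℝ (TangentSpace IL p)} {p : L}

/-- `∇(TY) - T ∇Y` depends only on the value of `Y` at the point. -/
theorem connTang_end_apply (hφ : IsIsometricImmersion φ)
    (hT : ∀ v : EL, ContMDiffAt IL IL.tangent ∞
      (fun p' => (⟨p', T p' (ofCoord IL p p' v)⟩ : TangentBundle IL L)) p)
    {Y : ∀ p : L, TangentSpace IL p}
    (hY : ContMDiffAt IL IL.tangent ∞ (fun p' => (⟨p', Y p'⟩ : TangentBundle IL L)) p)
    (X : TangentSpace IL p) :
    connTang φ (fun p' => T p' (Y p')) p X =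
      (connTang φ (fun p' => T p' (coordField IL p (Y p) p')) p X -
        T p (connTang φ (coordField IL p (Y p)) p X)) + T p (connTang φ Y p X) := by
  have hp := mem_chart_source HL p
  have hTY : ContMDiffAt IL IL.tangent ∞
      (fun p' => (⟨p', T p' (Y p')⟩ : TangentBundle IL L)) p :=
    ContMDiffWithinAt.section_end_apply (b := fun p' => p') hp hT hY
  have hTV := hT (toCoord IL p p (Y p))
  rw [connTang_eq_add_coordField hφ hTY, connTang_eq_add_coordField hφ hY,
    connTang_eq_add_coordField (Y := fun p' => T p' (coordField IL p (Y p) p')) hφ hTV,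
    coordField_self]
  let F : L → EL →L[ℝ] EL := fun p' => endCoord IL p p' (T p')
  have hF : MDifferentiableAt IL 𝓘(ℝ, EL →L[ℝ] EL) F p :=
    ContMDiffAt.mdifferentiableAt (n := ∞)
      (contMDiffWithinAt_endCoord (b := fun p' => p') hp hT) (by simp)
  have hYc : MDifferentiableAt IL 𝓘(ℝ, EL) (fun p' => toCoord IL p p' (Y p')) p :=
    hY.mdifferentiableAt_toCoord (b := id) hp
  have h1 : (fun p' => toCoord IL p p' (T p' (Y p'))) =ᶠ[𝓝 p]
      fun p' => F p' (toCoord IL p p' (Y p')) := by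
    filter_upwards [(chartAt HL p).open_source.mem_nhds hp] with p' hp'
    exact (endCoord_toCoord hp' _ _).symm
  have h2 : (fun p' => toCoord IL p p' (T p' (coordField IL p (Y p) p'))) =ᶠ[𝓝 p]
      fun p' => F p' (toCoord IL p p (Y p)) := by
    filter_upwards [(chartAt HL p).open_source.mem_nhds hp] with p' hp'
    rfl
  rw [h1.mvfderiv_eq, h2.mvfderiv_eq, mvfderiv_clm_apply hF hYc, mvfderiv_clm_apply_const hF,
    map_add, map_add]
  have h3 (v : EL) : ofCoord IL p p (F p v) = T p (ofCoord IL p p v) := ofCoord_toCoord hp _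
  rw [h3]
  abel

/-- The covariant derivative of a field of selfadjoint endomorphisms is selfadjoint. -/
theorem inner_connTang_end_symm
    [IsContMDiffRiemannianBundle IM ∞ EM (fun x : M => TangentSpace IM x)]
    (hφ : IsIsometricImmersion φ)
    (hT : ∀ v : EL, ContMDiffAt IL IL.tangent ∞
      (fun p' => (⟨p', T p' (ofCoord IL p p' v)⟩ : TangentBundle IL L)) p)
    (hs : ∀ p', (T p').IsSymmetric) (X v w : TangentSpace IL p) :
    (⟪connTang φ (fun p' => T p' (coordField IL p v p')) p X -
        T p (connTang φ (coordField IL p v) p X), w⟫ : ℝ) =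
      ⟪v, connTang φ (fun p' => T p' (coordField IL p w p')) p X -
        T p (connTang φ (coordField IL p w) p X)⟫ := by
  have hp := mem_chart_source HL p
  have hc (u : TangentSpace IL p) : ContMDiffAt IL IL.tangent ∞
      (fun p' => (⟨p', coordField IL p u p'⟩ : TangentBundle IL L)) p :=
    contMDiffAt_section_ofCoord hp _
  have hTc (u : TangentSpace IL p) : ContMDiffAt IL IL.tangent ∞
      (fun p' => (⟨p', T p' (coordField IL p u p')⟩ : TangentBundle IL L)) p := hT _
  have h1 := mvfderiv_inner_eq_connTang hφ (hTc v) (hc w) X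
  have h2 := mvfderiv_inner_eq_connTang hφ (hc v) (hTc w) X
  have h3 : (fun p' => (⟪T p' (coordField IL p v p'), coordField IL p w p'⟫ : ℝ)) =
      fun p' => (⟪coordField IL p v p', T p' (coordField IL p w p')⟫ : ℝ) :=
    funext fun p' => hs p' _ _
  rw [h3, h2, coordField_self, coordField_self] at h1
  rw [inner_sub_left, inner_sub_right, hs p, ← hs p v]
  linarith

end EndDerivative

/-! ### The horizontal lift -/

section FrameBundle

variable {EL : Type*} [NormedAddCommGroup EL] [NormedSpace ℝ EL]
  {HL : Type*} [TopologicalSpace HL] {IL : ModelWithCorners ℝ EL HL}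
  {L : Type*} [TopologicalSpace L] [ChartedSpace HL L]
  {EM : Type*} [NormedAddCommGroup EM] [NormedSpace ℝ EM]
  {HM : Type*} [TopologicalSpace HM] {IM : ModelWithCorners ℝ EM HM}
  {M : Type*} [TopologicalSpace M] [ChartedSpace HM M] [IsManifold IM ∞ M]
  [RiemannianBundle (fun x : M => TangentSpace IM x)]
  {φ : C^∞⟮IL, L; IM, M⟯} {q : ℕ} {P : Set (Tuples φ q)}

/-- Both `O(T^⊥ L)` and `SO(T^⊥ L)` are open in `O(T^⊥ L)`. -/
theorem IsNormalFrameBundle.exists_isOpen (hP : IsNormalFrameBundle φ P) :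
    ∃ U : Set (Tuples φ q), IsOpen U ∧ P = orthonormalFrames φ q ∩ U := by
  rcases hP with rfl | hP
  · exact ⟨Set.univ, isOpen_univ, (Set.inter_univ _).symm⟩
  · exact hP.1

theorem IsNormalFrameBundle.subset (hP : IsNormalFrameBundle φ P) :
    P ⊆ orthonormalFrames φ q := by
  obtain ⟨U, -, rfl⟩ := hP.exists_isOpen
  exact Set.inter_subset_left

end FrameBundle

section HorizontalLift

variable {EL : Type*} [NormedAddCommGroup EL] [NormedSpace ℝ EL] [FiniteDimensional ℝ EL]
  {HL : Type*} [TopologicalSpace HL] {IL : ModelWithCorners ℝ EL HL}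
  {L : Type*} [TopologicalSpace L] [ChartedSpace HL L] [IsManifold IL ∞ L]
  [RiemannianBundle (fun p : L => TangentSpace IL p)]
  [IsContMDiffRiemannianBundle IL ∞ EL (fun p : L => TangentSpace IL p)]
  {EM : Type*} [NormedAddCommGroup EM] [NormedSpace ℝ EM] [FiniteDimensional ℝ EM]
  {HM : Type*} [TopologicalSpace HM] {IM : ModelWithCorners ℝ EM HM}
  {M : Type*} [TopologicalSpace M] [ChartedSpace HM M] [IsManifold IM ∞ M]
  [RiemannianBundle (fun x : M => TangentSpace IM x)]
  [IsContMDiffRiemannianBundle IM ∞ EM (fun x : M => TangentSpace IM x)]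
  {φ : C^∞⟮IL, L; IM, M⟯} {q : ℕ} {P : Set (Tuples φ q)} {x : Tuples φ q}

/-- Horizontal lifts exist. -/
theorem exists_mem_horizontalSpace (hφ : IsIsometricImmersion φ) (hP : IsNormalFrameBundle φ P)
    (hx : x ∈ P) (X : TangentSpace IL x.proj) :
    ∃ ξ ∈ horizontalSpace φ P x,
      mfderiv (tuplesModel q IL EM) IL (fun y : Tuples φ q => y.proj) x ξ = X := by
  obtain ⟨U, hU, hPU⟩ := hP.exists_isOpen
  obtain ⟨p, f⟩ := x
  have hxP := hx
  rw [hPU] at hx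
  choose V hV hVn hVp hVX using fun α =>
    exists_normal_field_connNor_eq_zero hφ (hx.1.2 α) X
  obtain ⟨W, hW, hWn, hWp, hWo, hWX⟩ := exists_orthonormal_frame_of_orthonormal hV hVn
    (by simpa only [hVp] using hx.1.1) hVX
  have hs := contMDiffAt_tupleOf hW
  have hsp : (tupleOf fun α => W α p) = f := by
    simp only [hWp, hVp]
    exact tupleOf_vec f
  have hvec (p' : L) (α : Fin q) :
      Tuples.vec φ (⟨p', tupleOf fun α => W α p'⟩ : Tuples φ q) α = W α p' :=
    vec_tupleOf (fun α => W α p') α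
  subst hsp
  refine ⟨_, ⟨X, fun p' => tupleOf fun α => W α p', ?_, hs, rfl, fun α => ?_, rfl⟩,
    mfderiv_proj_mfderiv_section hs X⟩
  · filter_upwards [hWo, hs.continuousAt.eventually (hU.mem_nhds hx.2)] with p' h1 h2
    rw [hPU]
    refine ⟨⟨?_, fun α Z => ?_⟩, h2⟩
    · change Orthonormal ℝ (Tuples.vec φ (⟨p', tupleOf fun α => W α p'⟩ : Tuples φ q))
      rw [funext (hvec p')]
      exact h1
    · exact (congrArg (fun w => (⟪w, diff φ p' Z⟫ : ℝ)) (hvec p' α)).trans (hWn α p' Z)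
  · simp only [hvec]
    exact hWX α

theorem horizontalLift_spec (hφ : IsIsometricImmersion φ) (hP : IsNormalFrameBundle φ P)
    (hx : x ∈ P) (X : TangentSpace IL x.proj) :
    horizontalLift φ P x X ∈ horizontalSpace φ P x ∧
      mfderiv (tuplesModel q IL EM) IL (fun y : Tuples φ q => y.proj) x
        (horizontalLift φ P x X) = X :=
  Classical.epsilon_spec (exists_mem_horizontalSpace hφ hP hx X)

theorem mvfderiv_fibreCoord_of_mem_horizontalSpace (hφ : IsIsometricImmersion φ)
    (hP : P ⊆ orthonormalFrames φ q) {ξ : TangentSpace (tuplesModel q IL EM) x}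
    (hξ : ξ ∈ horizontalSpace φ P x) {X : TangentSpace IL x.proj}
    (hX : mfderiv (tuplesModel q IL EM) IL (fun y : Tuples φ q => y.proj) x ξ = X) (α : Fin q) :
    mvfderiv (tuplesModel q IL EM) (fibreCoord φ q x.proj) x ξ (EuclideanSpace.single α 1) =
    toCoord IM (φ x.proj) (φ x.proj) (-diff φ x.proj (shape φ x.proj (Tuples.vec φ x α) X) -
      christoffel IM (φ x.proj) (Tuples.vec φ x α) (diff φ x.proj X)) := by
  obtain ⟨X', s, h1, h2, h3, h4, rfl⟩ := hξ
  obtain ⟨p, f⟩ := x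
  dsimp only at h1 h2 h3 h4 X' X
  subst h3
  have hXX : X' = X := (mfderiv_proj_mfderiv_section h2 X').symm.trans hX
  subst hXX
  exact mvfderiv_fibreCoord_mfderiv_section hφ (h1.mono fun _ h => hP h) h2 h4 α

/-- The horizontal lift of `X` is determined by `X` and linear in it. -/
theorem isLinearMap_horizontalLift (hφ : IsIsometricImmersion φ) (hP : IsNormalFrameBundle φ P)
    (hx : x ∈ P) : IsLinearMap ℝ (horizontalLift φ P x) := by
  have h1 (X) := (horizontalLift_spec hφ hP hx X).2
  have h2 (X) := mvfderiv_fibreCoord_of_mem_horizontalSpace hφ hP.subset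
    (horizontalLift_spec hφ hP hx X).1 (h1 X)
  constructor
  · intro X Y
    refine eq_of_mfderiv_proj_eq_of_mvfderiv_fibreCoord_eq ?_ fun α => ?_
    · rw [ContinuousLinearMap.map_add, h1, h1, h1]
    · rw [ContinuousLinearMap.map_add, add_apply, h2, h2, h2]
      simp only [map_add, map_sub, map_neg]
      abel
  · intro c X
    refine eq_of_mfderiv_proj_eq_of_mvfderiv_fibreCoord_eq ?_ fun α => ?_
    · rw [ContinuousLinearMap.map_smul, h1, h1]
    · rw [ContinuousLinearMap.map_smul, smul_apply, h2, h2]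
      simp only [map_smul, map_sub, map_neg, smul_sub, smul_neg]

end HorizontalLift

/-! ### The connection in `End(E)` -/

section EndConnection

variable {EL : Type*} [NormedAddCommGroup EL] [NormedSpace ℝ EL] [FiniteDimensional ℝ EL]
  {HL : Type*} [TopologicalSpace HL] {IL : ModelWithCorners ℝ EL HL}
  {L : Type*} [TopologicalSpace L] [ChartedSpace HL L] [IsManifold IL ∞ L]
  [RiemannianBundle (fun p : L => TangentSpace IL p)]
  {EM : Type*} [NormedAddCommGroup EM] [NormedSpace ℝ EM] [FiniteDimensional ℝ EM]
  {HM : Type*} [TopologicalSpace HM] {IM : ModelWithCorners ℝ EM HM}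
  {M : Type*} [TopologicalSpace M] [ChartedSpace HM M] [IsManifold IM ∞ M]
  [RiemannianBundle (fun x : M => TangentSpace IM x)]
  {φ : C^∞⟮IL, L; IM, M⟯} {q : ℕ} {P : Set (Tuples φ q)} {x : Tuples φ q}
  {T : ∀ x : Tuples φ q, Module.End ℝ (TangentSpace IL x.proj)}

/-- The Leibniz rule `∇^E (TY) = (∇^E T) Y + T ∇^E Y` in horizontal directions. -/
theorem connE_end_apply (hφ : IsIsometricImmersion φ)
    (hT : ∀ v : EL, ContMDiffAt (tuplesModel q IL EM) IL.tangent ∞ (fun y : Tuples φ q =>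
      (⟨y.proj, T y (ofCoord IL x.proj y.proj v)⟩ : TangentBundle IL L)) x)
    {Y : ∀ y : Tuples φ q, TangentSpace IL y.proj}
    (hY : ContMDiffWithinAt (tuplesModel q IL EM) IL.tangent ∞
      (fun y => (⟨y.proj, Y y⟩ : TangentBundle IL L)) P x)
    {ξ : TangentSpace (tuplesModel q IL EM) x} (hξ : ξ ∈ horizontalSpace φ P x) :
    connE φ P (fun y => T y (Y y)) x ξ =
      connEnd φ P T x ξ (Y x) + T x (connE φ P Y x ξ) := by
  obtain ⟨X, s, h1, h2, h3, -, rfl⟩ := hξ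
  obtain ⟨p, f⟩ := x
  dsimp only at h1 h2 h3 X
  subst h3
  have hp := mem_chart_source HL p
  have hc : ContMDiffWithinAt (tuplesModel q IL EM) IL.tangent ∞ (fun y : Tuples φ q =>
      (⟨y.proj, coordField IL p (Y ⟨p, s p⟩) y.proj⟩ : TangentBundle IL L)) P ⟨p, s p⟩ :=
    ContMDiffWithinAt.section_ofCoord (b := fun y : Tuples φ q => y.proj) hp
      contMDiff_proj.contMDiffAt.contMDiffWithinAt contMDiffWithinAt_const
  have hTY : ContMDiffWithinAt (tuplesModel q IL EM) IL.tangent ∞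
      (fun y : Tuples φ q => (⟨y.proj, T y (Y y)⟩ : TangentBundle IL L)) P ⟨p, s p⟩ :=
    ContMDiffWithinAt.section_end_apply (b := fun y : Tuples φ q => y.proj) hp
      (fun v => (hT v).contMDiffWithinAt) hY
  rw [connEnd, connE_mfderiv_section hφ h1 h2 hTY, connE_mfderiv_section hφ h1 h2 hY,
    connE_mfderiv_section hφ h1 h2 hc, connE_mfderiv_section hφ h1 h2
      (U := fun y => T y (coordField IL p (Y ⟨p, s p⟩) y.proj)) (hT _).contMDiffWithinAt]
  have hYs : ContMDiffAt IL IL.tangent ∞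
      (fun p' => (⟨p', Y ⟨p', s p'⟩⟩ : TangentBundle IL L)) p :=
    (hY.comp p (h2.contMDiffWithinAt (s := (fun p' => (⟨p', s p'⟩ : Tuples φ q)) ⁻¹' P))
      fun _ h => h).contMDiffAt h1
  exact connTang_end_apply (T := fun p' => T ⟨p', s p'⟩) (Y := fun p' => Y ⟨p', s p'⟩) hφ
    (fun v => (hT v).comp p h2) hYs X

/-- The covariant derivative of a selfadjoint section of `End(E)` in a horizontal direction is
selfadjoint. -/
theorem inner_connEnd_symm
    [IsContMDiffRiemannianBundle IM ∞ EM (fun x : M => TangentSpace IM x)]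
    (hφ : IsIsometricImmersion φ)
    (hT : ∀ v : EL, ContMDiffAt (tuplesModel q IL EM) IL.tangent ∞ (fun y : Tuples φ q =>
      (⟨y.proj, T y (ofCoord IL x.proj y.proj v)⟩ : TangentBundle IL L)) x)
    (hs : ∀ y, (T y).IsSymmetric)
    {ξ : TangentSpace (tuplesModel q IL EM) x} (hξ : ξ ∈ horizontalSpace φ P x)
    (v w : TangentSpace IL x.proj) :
    (⟪connEnd φ P T x ξ v, w⟫ : ℝ) = ⟪v, connEnd φ P T x ξ w⟫ := by
  obtain ⟨X, s, h1, h2, h3, -, rfl⟩ := hξ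
  obtain ⟨p, f⟩ := x
  dsimp only at h1 h2 h3 X v w
  subst h3
  have hp := mem_chart_source HL p
  have hc (u : TangentSpace IL p) : ContMDiffWithinAt (tuplesModel q IL EM) IL.tangent ∞
      (fun y : Tuples φ q => (⟨y.proj, coordField IL p u y.proj⟩ : TangentBundle IL L))
      P ⟨p, s p⟩ :=
    ContMDiffWithinAt.section_ofCoord (b := fun y : Tuples φ q => y.proj) hp
      contMDiff_proj.contMDiffAt.contMDiffWithinAt contMDiffWithinAt_const
  have h5 (u : TangentSpace IL p) : connEnd φ P T ⟨p, s p⟩ (mfderiv IL (tuplesModel q IL EM)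
      (fun p' => (⟨p', s p'⟩ : Tuples φ q)) p X) u =
      connTang φ (fun p' => T ⟨p', s p'⟩ (coordField IL p u p')) p X -
        T ⟨p, s p⟩ (connTang φ (coordField IL p u) p X) := by
    rw [connEnd, connE_mfderiv_section hφ h1 h2 (hc u), connE_mfderiv_section hφ h1 h2
      (U := fun y => T y (coordField IL p u y.proj)) (hT _).contMDiffWithinAt]
  rw [h5, h5]
  exact inner_connTang_end_symm (T := fun p' => T ⟨p', s p'⟩) hφ (fun v => (hT v).comp p h2)
    (fun p' => hs _) X v w

end EndConnection

/-- `tr(AB) = tr(BA)`, with the two traces computed in different orthonormal bases. -/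
theorem sum_inner_comp_eq_sum_inner_comp {F ι κ : Type*} [NormedAddCommGroup F]
    [InnerProductSpace ℝ F] [Fintype ι] [Fintype κ] (b : OrthonormalBasis κ ℝ F)
    (e : OrthonormalBasis ι ℝ F) (A B : Module.End ℝ F) :
    ∑ k, (⟪A (B (b k)), b k⟫ : ℝ) = ∑ i, ⟪B (A (e i)), e i⟫ := by
  have h1 := LinearMap.trace_eq_sum_inner (A * B) b
  have h2 := LinearMap.trace_eq_sum_inner (B * A) e
  rw [LinearMap.trace_mul_comm, h2] at h1
  simpa only [real_inner_comm, Module.End.mul_apply] using h1.symm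

end

theorem mainTheorem5
    {EL : Type*} [NormedAddCommGroup EL] [NormedSpace ℝ EL] [FiniteDimensional ℝ EL]
    {HL : Type*} [TopologicalSpace HL] {IL : ModelWithCorners ℝ EL HL}
    {L : Type*} [TopologicalSpace L] [ChartedSpace HL L] [IsManifold IL ∞ L]
    [RiemannianBundle (fun p : L => TangentSpace IL p)]
    [IsContMDiffRiemannianBundle IL ∞ EL (fun p : L => TangentSpace IL p)]
    {EM : Type*} [NormedAddCommGroup EM] [NormedSpace ℝ EM] [FiniteDimensional ℝ EM]
    {HM : Type*} [TopologicalSpace HM] {IM : ModelWithCorners ℝ EM HM}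
    {M : Type*} [TopologicalSpace M] [ChartedSpace HM M] [IsManifold IM ∞ M]
    [RiemannianBundle (fun x : M => TangentSpace IM x)]
    [IsContMDiffRiemannianBundle IM ∞ EM (fun x : M => TangentSpace IM x)]
    (φ : C^∞⟮IL, L; IM, M⟯) (hφ : IsIsometricImmersion φ)
    (q : ℕ) (hq : Module.finrank ℝ EM = Module.finrank ℝ EL + q)
    (P : Set (Tuples φ q)) (hP : IsNormalFrameBundle φ P)
    (u : Fin q →₀ ℕ)
    (Y : ∀ x : Tuples φ q, TangentSpace IL x.proj) (hY : IsSmoothSection φ P Y)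
    (x : Tuples φ q) (hx : x ∈ P)
    {ι : Type*} [Fintype ι] (e : OrthonormalBasis ι ℝ (TangentSpace IL x.proj)) :
    divE φ P (fun y => newtonE φ u y (Y y)) x =
      ∑ i, ⟪connE φ P Y x (horizontalLift φ P x (newtonE φ u x (e i))), e i⟫ +
        ⟪divEnd φ P (newtonE φ u) x, Y x⟫ := by
  have hT := contMDiffAt_newtonE_ofCoord hφ u x
  have hs := newtonE_isSymmetric hφ u (IL := IL) (IM := IM) (q := q)
  have hlift (X) := (horizontalLift_spec hφ hP hx X).1
  -- `B X = ∇^E_{X^h} Y`; the two sums to be compared are `tr(T_u B)` and `tr(B T_u)`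
  let B : Module.End ℝ (TangentSpace IL x.proj) :=
    connE φ P Y x ∘ₗ (isLinearMap_horizontalLift hφ hP hx).mk' _
  have htr := sum_inner_comp_eq_sum_inner_comp (stdOrthonormalBasis ℝ (TangentSpace IL x.proj)) e
    (newtonE φ u x) B
  rw [divE, divEnd, sum_inner]
  refine Eq.trans ?_ (congrArg (· + _) htr)
  rw [← Finset.sum_add_distrib]
  refine Finset.sum_congr rfl fun i _ => ?_
  rw [connE_end_apply hφ hT (hY x hx) (hlift _), inner_add_left, add_comm,
    inner_connEnd_symm hφ hT hs (hlift _), real_inner_comm _ (Y x)]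
  rfl
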